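/- For a positive integer $n$, let $B_n$ be the hyperoctahedral group of all permutations $\pi$ of $\{-n,\ldots,n\}\setminus\{0\}$ with $\pi(-i)=-\pi(i)$ for all $i$. Its Coxeter generators are $s_0$, which interchanges $1$ and $-1$, and, for $1\le i\le n-1$, $s_i$, which interchanges $i$ with $i+1$ and $-i$ with $-(i+1)$. Let $\ell$ be the length function with respect to these generators. The strong Bruhat order on $B_n$ is the reflexive and transitive closure of the relations $\sigma<t\sigma$, where $t$ is a conjugate of a Coxeter generator and $\ell(\sigma)<\ell(t\sigma)$. For $\pi\in B_n$, let $d_-^B(\pi)$ be the number of elements of $B_n$ covered by $\pi$ in this order, let $d_+^B(\pi)$ be the number of elements that cover $\pi$, and let $d^B(\pi)=d_-^B(\pi)+d_+^B(\pi)$ be the total degree of $\pi$, that is, its valency in the Hasse diagram. **Theorem.** $$\max\{d^B(\pi) : \pi\in B_n\}=\begin{cases}4(n-1), & 2\le n\le 5,\\ \lfloor n^2/2\rfloor+n-1, & n\ge 5.\end{cases}$$ -/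

import Mathlib

section Bruhat

variable {G : Type*} [Group G]

/-- The length of `g` with respect to a set `S` of generators (each its own inverse in the
Coxeter case): the least `k` such that `g` is a product of `k` elements of `S`. -/
noncomputable def wordLength (S : Set G) (g : G) : ℕ :=
  sInf {k : ℕ | ∃ l : List G, (∀ s ∈ l, s ∈ S) ∧ l.prod = g ∧ l.length = k}

/-- The reflections: all conjugates of the Coxeter generators in `S`. -/
def IsBruhatReflection (S : Set G) (t : G) : Prop :=
  ∃ s ∈ S, ∃ w : G, t = w * s * w⁻¹

/-- An arrow `g → h` of the Bruhat graph: `h = t g` for a reflection `t`, and `h` is longer. -/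
def BruhatStep (S : Set G) (g h : G) : Prop :=
  ∃ t : G, IsBruhatReflection S t ∧ h = t * g ∧ wordLength S g < wordLength S h

/-- The strong Bruhat order: the reflexive transitive closure of the Bruhat graph. -/
def BruhatLE (S : Set G) : G → G → Prop :=
  Relation.ReflTransGen (BruhatStep S)

theorem BruhatLE.eq_or_length_lt {S : Set G} {g h : G} (hgh : BruhatLE S g h) :
    g = h ∨ wordLength S g < wordLength S h := by
  induction hgh with
  | refl => exact Or.inl rfl
  | tail _ hs ih =>
    obtain ⟨t, -, -, hlt⟩ := hs
    rcases ih with rfl | ih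
    · exact Or.inr hlt
    · exact Or.inr (ih.trans hlt)

/-- The strong Bruhat order as a partial order. -/
@[reducible] def bruhatPartialOrder (S : Set G) : PartialOrder G where
  le := BruhatLE S
  le_refl _ := Relation.ReflTransGen.refl
  le_trans _ _ _ h₁ h₂ := Relation.ReflTransGen.trans h₁ h₂
  le_antisymm _ _ h₁ h₂ := by
    rcases h₁.eq_or_length_lt with h | h
    · exact h
    · rcases h₂.eq_or_length_lt with h' | h'
      · exact h'.symm
      · exact absurd h (lt_asymm h')

end Bruhat

/-- The set `{-n, …, n} \ {0}`. -/
abbrev SignedIdx (n : ℕ) : Type :=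
  {x : ℤ // x ∈ (Finset.Icc (-(n : ℤ)) (n : ℤ)).erase 0}

/-- The map `i ↦ -i` on `{-n, …, n} \ {0}`. -/
def SignedIdx.neg {n : ℕ} (i : SignedIdx n) : SignedIdx n :=
  ⟨-i.1, by
    have h := i.2
    simp only [Finset.mem_erase, Finset.mem_Icc] at h ⊢
    omega⟩

theorem SignedIdx.neg_neg {n : ℕ} (i : SignedIdx n) : i.neg.neg = i :=
  Subtype.ext (_root_.neg_neg i.1)

/-- The hyperoctahedral group `B_n`: the permutations `π` of `{-n, …, n} \ {0}` such that
`π (-i) = -π i` for all `i`. -/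
def hyperoctahedralGroup (n : ℕ) : Subgroup (Equiv.Perm (SignedIdx n)) where
  carrier := {π | ∀ i, π i.neg = (π i).neg}
  one_mem' := fun _ => rfl
  mul_mem' := by
    intro π σ hπ hσ i
    rw [Equiv.Perm.mul_apply, Equiv.Perm.mul_apply, hσ i, hπ (σ i)]
  inv_mem' := by
    intro π hπ i
    apply π.injective
    have h : π (π⁻¹ i).neg = (π (π⁻¹ i)).neg := hπ (π⁻¹ i)
    rw [h]
    simp

/-- Signed permutations. -/
abbrev SignedPerm (n : ℕ) : Type := hyperoctahedralGroup n

theorem swap_neg_apply {n : ℕ} (a b i : SignedIdx n) :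
    Equiv.swap a.neg b.neg i.neg = (Equiv.swap a b i).neg := by
  have hinj : Function.Injective (SignedIdx.neg (n := n)) :=
    Function.LeftInverse.injective SignedIdx.neg_neg
  exact (hinj.map_swap a b i).symm

/-- The signed permutation `u_{a,b}`: it interchanges `a` with `b` and `-a` with `-b`. It is the
single transposition of `a` and `-a` if `b = -a`. -/
def signedSwap {n : ℕ} (a b : SignedIdx n) : SignedPerm n :=
  ⟨if b = a.neg then Equiv.swap a b else Equiv.swap a b * Equiv.swap a.neg b.neg, by
    split_ifs with h
    · subst h
      intro i
      rw [← swap_neg_apply, SignedIdx.neg_neg, Equiv.swap_comm]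
    · by_cases hab : b = a
      · subst hab
        intro i
        simp
      · intro i
        have hc : Equiv.swap a b * Equiv.swap a.neg b.neg
            = Equiv.swap a.neg b.neg * Equiv.swap a b := by
          apply Equiv.Perm.Disjoint.commute
          have e1 : a ≠ a.neg := by
            intro e
            have e' : a.1 = -a.1 := congrArg Subtype.val e
            have := a.2
            simp only [Finset.mem_erase, Finset.mem_Icc] at this
            omega
          have e2 : b ≠ b.neg := by
            intro e
            have e' : b.1 = -b.1 := congrArg Subtype.val e
            have := b.2
            simp only [Finset.mem_erase, Finset.mem_Icc] at this
            omega
          have e3 : a ≠ b.neg := by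
            intro e
            exact h (by rw [e, SignedIdx.neg_neg])
          have e4 : a.neg ≠ b.neg := by
            intro e
            exact hab (by rw [← SignedIdx.neg_neg b, ← e, SignedIdx.neg_neg])
          intro x
          by_cases hx : x = a ∨ x = b
          · right
            rcases hx with rfl | rfl
            · exact Equiv.swap_apply_of_ne_of_ne e1 e3
            · exact Equiv.swap_apply_of_ne_of_ne h e2
          · push Not at hx
            exact Or.inl (Equiv.swap_apply_of_ne_of_ne hx.1 hx.2)
        conv_lhs => rw [hc]
        rw [Equiv.Perm.mul_apply, Equiv.Perm.mul_apply, ← swap_neg_apply, ← swap_neg_apply]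
        simp only [SignedIdx.neg_neg]
        ⟩

/-- The Coxeter generators of `B_n`: `s_0 = u_{1,-1}`, and `s_i = u_{i,i+1}` for `1 ≤ i ≤ n - 1`. -/
def coxeterGenerators (n : ℕ) : Set (SignedPerm n) :=
  {s | ∃ a : SignedIdx n, a.1 = 1 ∧ s = signedSwap a a.neg} ∪
  {s | ∃ a b : SignedIdx n, 1 ≤ a.1 ∧ b.1 = a.1 + 1 ∧ s = signedSwap a b}

/-- `B_n` with the strong Bruhat order. -/
instance SignedPerm.instPartialOrder (n : ℕ) : PartialOrder (SignedPerm n) :=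
  bruhatPartialOrder (coxeterGenerators n)

/-- The number of signed permutations covered by `π` in the strong Bruhat order. -/
noncomputable def downDegree {n : ℕ} (π : SignedPerm n) : ℕ :=
  Set.ncard {σ : SignedPerm n | σ ⋖ π}

/-- The number of signed permutations covering `π` in the strong Bruhat order. -/
noncomputable def upDegree {n : ℕ} (π : SignedPerm n) : ℕ :=
  Set.ncard {σ : SignedPerm n | π ⋖ σ}

/-- The valency of `π` in the Hasse diagram of the strong Bruhat order. -/
noncomputable def totalDegree {n : ℕ} (π : SignedPerm n) : ℕ :=
  downDegree π + upDegree π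

/-! Draw `π` as the centrally symmetric set of points `(i, π i)`. Multiplying by the reflection that
interchanges positions `i < j` with `π i < π j` goes up in Bruhat order. It is a covering exactly
when no point of the diagram lies in the open rectangle spanned by the two points and, unless `j =
-i`, the origin does not lie there either; this is `FreePair`. Interchanging the two values
preserves the condition, so downward coverings are described by the same pairs. Hence the total
degree counts free pairs modulo negation and order (`SignedPerm.totalDegree_eq`), and the theorem
becomes extremal graph theory. Free pairs are defined over an arbitrary finite symmetric set `S` of
positions, so that positions can be deleted without renumbering; deletion only makes more pairs
free.

Write `f n = ⌊n²/2⌋ + n - 1`. Then `f n - f (n-1) ≥ n` and `f n - f (n-2) = 2n`. The induction in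
`card_freeEdges_le_of_five_le` therefore needs one position with at most `n` free neighbours, or two
positions with at most `2n` incident edges together. `exists_few_edges` supplies one of these. If
both fail, take a longest nonsymmetric free pair `p, q`, normalised to `|q| < p` and `w p > 0`. The
degree bound forces many common neighbours. By maximality those other than `-p, -q` lie between `q`
and `p`; their values lie above both or below both of `w p, w q`, with at most one of each kind.
Hence equality holds in every count. The resulting rigid picture is `TightConfig`, and there some
further position has at most `n` neighbours after all.

For `n ≤ 5` the bound `4(n-1)` is checked by a kernel enumeration that adds positions from the
inside outwards. The case `n = 6` lies outside the induction, because `f 4 = 11` is smaller than the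
true maximum 12; averaging over deleted positions handles it. The lower bounds come from negating
the first half of the positions and reversing the second half, and from explicit signed permutations
for `n ≤ 4`. -/

/-! ### Free pairs of a signed configuration, and their deletion bounds. -/

/-- `b` lies strictly between `a` and `c`. -/
def StrictBtw (a b c : ℤ) : Prop := (a < b ∧ b < c) ∨ (c < b ∧ b < a)

instance (a b c : ℤ) : Decidable (StrictBtw a b c) := by unfold StrictBtw; infer_instance

/-- The point `(k, w k)` lies in the open rectangle spanned by `(i, w i)` and `(j, w j)`. -/
def Blocks (w : ℤ → ℤ) (i j k : ℤ) : Prop := StrictBtw i k j ∧ StrictBtw (w i) (w k) (w j)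

instance (w : ℤ → ℤ) (i j k : ℤ) : Decidable (Blocks w i j k) := by unfold Blocks; infer_instance

/-- No point over `S` blocks the pair `i, j`, and the origin does not block it either, unless the
pair is symmetric. -/
def FreePair (w : ℤ → ℤ) (S : Finset ℤ) (i j : ℤ) : Prop :=
  i ≠ j ∧ (∀ k ∈ S, ¬ Blocks w i j k) ∧ (j = -i ∨ ¬ Blocks w i j 0)

instance (w : ℤ → ℤ) (S : Finset ℤ) (i j : ℤ) : Decidable (FreePair w S i j) := by
  unfold FreePair; infer_instance

/-- `w` is an odd injective function, and `S` is a symmetric set of nonzero positions. -/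
structure SignedConfig (w : ℤ → ℤ) (S : Finset ℤ) : Prop where
  odd : ∀ i, w (-i) = -w i
  inj : Function.Injective w
  neg_mem : ∀ i ∈ S, -i ∈ S
  zero_notMem : (0 : ℤ) ∉ S

/-- The positions that form a free pair with `i`. -/
def freeNbrs (w : ℤ → ℤ) (S : Finset ℤ) (i : ℤ) : Finset ℤ := S.filter (FreePair w S i)

/-- Representatives of the free pairs modulo negation and order. -/
def freeEdges (w : ℤ → ℤ) (S : Finset ℤ) : Finset (ℤ × ℤ) :=
  (S ×ˢ S).filter fun e => -e.2 ≤ e.1 ∧ e.1 < e.2 ∧ FreePair w S e.1 e.2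

theorem mem_freeNbrs {w : ℤ → ℤ} {S : Finset ℤ} {i j : ℤ} :
    j ∈ freeNbrs w S i ↔ j ∈ S ∧ FreePair w S i j := Finset.mem_filter

theorem mem_freeEdges {w : ℤ → ℤ} {S : Finset ℤ} {e : ℤ × ℤ} :
    e ∈ freeEdges w S ↔
      (e.1 ∈ S ∧ e.2 ∈ S) ∧ -e.2 ≤ e.1 ∧ e.1 < e.2 ∧ FreePair w S e.1 e.2 := by
  rw [freeEdges, Finset.mem_filter, Finset.mem_product]

theorem Blocks.symm {w : ℤ → ℤ} {i j k : ℤ} (h : Blocks w i j k) : Blocks w j i k := by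
  simp only [Blocks, StrictBtw] at *; omega

theorem FreePair.symm {w : ℤ → ℤ} {S : Finset ℤ} {i j : ℤ} (h : FreePair w S i j) :
    FreePair w S j i :=
  ⟨h.1.symm, fun k hk hb => h.2.1 k hk hb.symm,
    h.2.2.imp (fun e => by omega) (fun hn hb => hn hb.symm)⟩

theorem freePair_comm {w : ℤ → ℤ} {S : Finset ℤ} {i j : ℤ} :
    FreePair w S i j ↔ FreePair w S j i := ⟨FreePair.symm, FreePair.symm⟩

theorem FreePair.mono {w : ℤ → ℤ} {S T : Finset ℤ} {i j : ℤ} (h : FreePair w S i j)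
    (hT : T ⊆ S) : FreePair w T i j :=
  ⟨h.1, fun k hk => h.2.1 k (hT hk), h.2.2⟩

theorem FreePair.not_blocks {w : ℤ → ℤ} {S : Finset ℤ} {i j : ℤ} (h : FreePair w S i j)
    {k : ℤ} (hk : k ∈ S) : ¬ (((i < k ∧ k < j) ∨ (j < k ∧ k < i)) ∧
      ((w i < w k ∧ w k < w j) ∨ (w j < w k ∧ w k < w i))) := h.2.1 k hk

namespace SignedConfig

variable {w : ℤ → ℤ} {S : Finset ℤ}

theorem map_zero (h : SignedConfig w S) : w 0 = 0 := by
  have := h.odd 0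
  simp only [neg_zero] at this
  omega

theorem ne_zero (h : SignedConfig w S) {i : ℤ} (hi : i ∈ S) : i ≠ 0 :=
  fun e => h.zero_notMem (e ▸ hi)

theorem map_ne_zero (h : SignedConfig w S) {i : ℤ} (hi : i ∈ S) : w i ≠ 0 :=
  fun e => h.ne_zero hi (h.inj (e.trans h.map_zero.symm))

theorem map_ne (h : SignedConfig w S) {i j : ℤ} (hij : i ≠ j) : w i ≠ w j :=
  fun e => hij (h.inj e)

theorem map_ne_neg (h : SignedConfig w S) {i j : ℤ} (hij : i ≠ -j) : w i ≠ -w j :=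
  fun e => hij (h.inj (e.trans (h.odd j).symm))

theorem neg_mem_iff (h : SignedConfig w S) {i : ℤ} : -i ∈ S ↔ i ∈ S :=
  ⟨fun hi => by simpa using h.neg_mem _ hi, h.neg_mem i⟩

theorem not_central (h : SignedConfig w S) {i j : ℤ} (hf : FreePair w S i j) (hij : j ≠ -i) :
    ¬ (((i < 0 ∧ 0 < j) ∨ (j < 0 ∧ 0 < i)) ∧
      ((w i < 0 ∧ 0 < w j) ∨ (w j < 0 ∧ 0 < w i))) := by
  have := hf.2.2.resolve_left hij
  simpa only [Blocks, StrictBtw, h.map_zero] using this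

theorem freePair_neg (h : SignedConfig w S) {i j : ℤ} (hf : FreePair w S i j) :
    FreePair w S (-i) (-j) := by
  have key : ∀ k, Blocks w (-i) (-j) k → Blocks w i j (-k) := by
    intro k hb
    simp only [Blocks, StrictBtw, h.odd] at *
    omega
  refine ⟨fun e => hf.1 (by omega), fun k hk hb => hf.2.1 _ (h.neg_mem k hk) (key k hb), ?_⟩
  refine hf.2.2.imp (fun e => by omega) (fun hn hb => hn ?_)
  simpa using key 0 hb

theorem freePair_neg_left (h : SignedConfig w S) {i j : ℤ} :
    FreePair w S (-i) j ↔ FreePair w S i (-j) :=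
  ⟨fun hf => by simpa using h.freePair_neg hf, fun hf => by simpa using h.freePair_neg hf⟩

/-- Reflecting the diagram in the horizontal axis preserves free pairs; this permits the
normalisation `0 < w p`. -/
theorem neg_values (h : SignedConfig w S) : SignedConfig (fun i => -w i) S :=
  ⟨fun i => by simp [h.odd], fun _ _ e => h.inj (neg_injective e), h.neg_mem, h.zero_notMem⟩

theorem freePair_neg_values (w : ℤ → ℤ) (S : Finset ℤ) (i j : ℤ) :
    FreePair (fun i => -w i) S i j ↔ FreePair w S i j := by
  have key : ∀ k, Blocks (fun i => -w i) i j k ↔ Blocks w i j k := by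
    intro k
    simp only [Blocks, StrictBtw]
    omega
  simp only [FreePair, key]

theorem freeNbrs_neg_values (w : ℤ → ℤ) (S : Finset ℤ) (i : ℤ) :
    freeNbrs (fun i => -w i) S i = freeNbrs w S i := by
  ext j
  simp only [mem_freeNbrs, freePair_neg_values]

theorem erase_pair (h : SignedConfig w S) (p : ℤ) : SignedConfig w (S \ {p, -p}) where
  odd := h.odd
  inj := h.inj
  neg_mem := fun i hi => by
    simp only [Finset.mem_sdiff, Finset.mem_insert, Finset.mem_singleton] at hi ⊢
    exact ⟨h.neg_mem i hi.1, by omega⟩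
  zero_notMem := fun h0 => h.zero_notMem (Finset.mem_sdiff.1 h0).1

theorem card_erase_pair (h : SignedConfig w S) {p : ℤ} (hp : p ∈ S) :
    (S \ {p, -p}).card + 2 = S.card := by
  have hp0 := h.ne_zero hp
  have h2 : ({p, -p} : Finset ℤ).card = 2 := Finset.card_pair (by omega)
  have hsub : ({p, -p} : Finset ℤ) ⊆ S := by
    intro x hx
    simp only [Finset.mem_insert, Finset.mem_singleton] at hx
    rcases hx with rfl | rfl
    · exact hp
    · exact h.neg_mem p hp
  have := Finset.card_sdiff_add_card_eq_card hsub
  omega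

/-- The free edges at `p` or `-p` are at most as many as the free neighbours of `p`. -/
theorem card_edges_at_le (h : SignedConfig w S) (p : ℤ) :
    ((freeEdges w S).filter fun e => e.1 = p ∨ e.1 = -p ∨ e.2 = p ∨ e.2 = -p).card
      ≤ (freeNbrs w S p).card := by
  classical
  refine Finset.card_le_card_of_injOn
    (fun e => if e.1 = p then e.2 else if e.1 = -p then -e.2 else if e.2 = p then e.1 else -e.1)
    ?_ ?_
  · rintro ⟨i, j⟩ he
    simp only [Finset.coe_filter, Set.mem_ofPred_eq, mem_freeEdges] at he
    obtain ⟨⟨⟨hi, hj⟩, h1, h2, hf⟩, hp⟩ := he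
    simp only [Finset.mem_coe, mem_freeNbrs]
    split_ifs with c1 c2 c3
    · exact ⟨hj, c1 ▸ hf⟩
    · refine ⟨h.neg_mem _ hj, ?_⟩
      have := h.freePair_neg hf
      rwa [c2, neg_neg] at this
    · exact ⟨hi, c3 ▸ hf.symm⟩
    · have c4 : j = -p := by tauto
      refine ⟨h.neg_mem _ hi, ?_⟩
      have := (h.freePair_neg hf).symm
      rwa [c4, neg_neg] at this
  · rintro ⟨i, j⟩ he ⟨i', j'⟩ he' heq
    simp only [Finset.coe_filter, Set.mem_ofPred_eq, mem_freeEdges] at he he'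
    obtain ⟨⟨⟨hi, hj⟩, h1, h2, hf⟩, hp⟩ := he
    obtain ⟨⟨⟨hi', hj'⟩, h1', h2', hf'⟩, hp'⟩ := he'
    simp only at heq
    rw [Prod.mk.injEq]
    split_ifs at heq <;> constructor <;> omega

/-- The free edges that have `p` or `-p` as an end. -/
def edgesAt (w : ℤ → ℤ) (S : Finset ℤ) (p : ℤ) : Finset (ℤ × ℤ) :=
  (freeEdges w S).filter fun e => e.1 = p ∨ e.1 = -p ∨ e.2 = p ∨ e.2 = -p

/-- An edge avoiding `±p` remains free after the deletion, because deleting points only removes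
obstructions. -/
theorem card_freeEdges_le_erase_pair_add_edgesAt (w : ℤ → ℤ) (S : Finset ℤ) (p : ℤ) :
    (freeEdges w S).card ≤ (freeEdges w (S \ {p, -p})).card + (edgesAt w S p).card := by
  rw [← Finset.card_filter_add_card_filter_not (s := freeEdges w S)
    (fun e => e.1 = p ∨ e.1 = -p ∨ e.2 = p ∨ e.2 = -p), add_comm]
  refine Nat.add_le_add_right (Finset.card_le_card ?_) _
  intro e he
  rw [Finset.mem_filter, mem_freeEdges] at he
  obtain ⟨⟨⟨hi, hj⟩, h1, h2, hf⟩, hp⟩ := he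
  simp only [not_or] at hp
  refine mem_freeEdges.2 ⟨⟨?_, ?_⟩, h1, h2, hf.mono Finset.sdiff_subset⟩
  · simp [hi, hp]
  · simp [hj, hp]

theorem card_freeEdges_le_erase_pair (h : SignedConfig w S) (p : ℤ) :
    (freeEdges w S).card ≤ (freeEdges w (S \ {p, -p})).card + (freeNbrs w S p).card :=
  (card_freeEdges_le_erase_pair_add_edgesAt w S p).trans
    (Nat.add_le_add_left (h.card_edges_at_le p) _)

/-- Inclusion-exclusion: the classes of `p, q` and of `p, -q`, when free, are counted both at `p`
and at `q`. -/
theorem card_freeEdges_le_erase_two_pairs (h : SignedConfig w S) {p q : ℤ} (hp : p ∈ S)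
    (hq : q ∈ S) (hpq : p ≠ q) (hpq' : p ≠ -q) :
    (freeEdges w S).card + (if FreePair w S p q then 1 else 0)
        + (if FreePair w S p (-q) then 1 else 0)
      ≤ (freeEdges w ((S \ {p, -p}) \ {q, -q})).card + (freeNbrs w S p).card
        + (freeNbrs w S q).card := by
  classical
  set A := (freeEdges w S).filter fun e => e.1 = p ∨ e.1 = -p ∨ e.2 = p ∨ e.2 = -p with hA
  set B := (freeEdges w S).filter fun e => e.1 = q ∨ e.1 = -q ∨ e.2 = q ∨ e.2 = -q with hB
  have hAc : A.card ≤ _ := h.card_edges_at_le p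
  have hBc : B.card ≤ _ := h.card_edges_at_le q
  have hcov : freeEdges w S ⊆ freeEdges w ((S \ {p, -p}) \ {q, -q}) ∪ (A ∪ B) := by
    intro e he
    by_cases hAe : e ∈ A
    · simp [hAe]
    by_cases hBe : e ∈ B
    · simp [hBe]
    refine Finset.mem_union_left _ ?_
    simp only [hA, hB, Finset.mem_filter, not_and, not_or] at hAe hBe
    have hAe := hAe he
    have hBe := hBe he
    rw [mem_freeEdges] at he
    obtain ⟨⟨hi, hj⟩, h1, h2, hf⟩ := he
    refine mem_freeEdges.2 ⟨⟨?_, ?_⟩, h1, h2,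
      hf.mono (Finset.sdiff_subset.trans Finset.sdiff_subset)⟩
    · simp [hi, hAe, hBe]
    · simp [hj, hAe, hBe]
  have h1 := (Finset.card_le_card hcov).trans (Finset.card_union_le _ _)
  have h2 := Finset.card_union_add_card_inter A B
  suffices hI : (if FreePair w S p q then 1 else 0) + (if FreePair w S p (-q) then 1 else 0)
      ≤ (A ∩ B).card by omega
  have hp0 := h.ne_zero hp
  have hq0 := h.ne_zero hq
  have hnp := h.neg_mem p hp
  have hnq := h.neg_mem q hq
  -- The class of a pair under negation and order has four members; whichever of them satisfies the
  -- normalisation in `freeEdges` is an edge at both `p` and `q`.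
  have rep : ∀ q' : ℤ, (q' = q ∨ q' = -q) → FreePair w S p q' →
      ∃ e ∈ A ∩ B, (e = (p, q') ∨ e = (-p, -q') ∨ e = (q', p) ∨ e = (-q', -p)) := by
    intro q' hq' hf
    have hqS : q' ∈ S := by rcases hq' with rfl | rfl <;> assumption
    have hnqS : -q' ∈ S := h.neg_mem _ hqS
    have hf' := h.freePair_neg hf
    have hcase : (-q' ≤ p ∧ p < q') ∨ (q' ≤ -p ∧ -p < -q') ∨ (-p ≤ q' ∧ q' < p)
        ∨ (p ≤ -q' ∧ -q' < -p) := by omega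
    rcases hcase with c | c | c | c
    · refine ⟨(p, q'), ?_, Or.inl rfl⟩
      simp only [hA, hB, Finset.mem_inter, Finset.mem_filter, mem_freeEdges]
      exact ⟨⟨⟨⟨hp, hqS⟩, c.1, c.2, hf⟩, by simp⟩, ⟨⟨hp, hqS⟩, c.1, c.2, hf⟩, by tauto⟩
    · refine ⟨(-p, -q'), ?_, by simp⟩
      simp only [hA, hB, Finset.mem_inter, Finset.mem_filter, mem_freeEdges]
      exact ⟨⟨⟨⟨hnp, hnqS⟩, by omega, c.2, hf'⟩, by simp⟩, ⟨⟨hnp, hnqS⟩, by omega, c.2, hf'⟩,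
        by rcases hq' with rfl | rfl <;> simp⟩
    · refine ⟨(q', p), ?_, by simp⟩
      simp only [hA, hB, Finset.mem_inter, Finset.mem_filter, mem_freeEdges]
      exact ⟨⟨⟨⟨hqS, hp⟩, c.1, c.2, hf.symm⟩, by simp⟩, ⟨⟨hqS, hp⟩, c.1, c.2, hf.symm⟩, by tauto⟩
    · refine ⟨(-q', -p), ?_, by simp⟩
      simp only [hA, hB, Finset.mem_inter, Finset.mem_filter, mem_freeEdges]
      exact ⟨⟨⟨⟨hnqS, hnp⟩, by omega, c.2, hf'.symm⟩, by simp⟩,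
        ⟨⟨hnqS, hnp⟩, by omega, c.2, hf'.symm⟩, by rcases hq' with rfl | rfl <;> simp⟩
  split_ifs with c1 c2 c2
  · obtain ⟨e1, m1, r1⟩ := rep q (Or.inl rfl) c1
    obtain ⟨e2, m2, r2⟩ := rep (-q) (Or.inr rfl) c2
    refine Finset.one_lt_card.2 ⟨e1, m1, e2, m2, ?_⟩
    rintro rfl
    rcases r1 with rfl | rfl | rfl | rfl <;> simp only [Prod.mk.injEq] at r2 <;> omega
  · obtain ⟨e1, m1, -⟩ := rep q (Or.inl rfl) c1
    exact Finset.card_pos.2 ⟨e1, m1⟩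
  · obtain ⟨e2, m2, -⟩ := rep (-q) (Or.inr rfl) c2
    exact Finset.card_pos.2 ⟨e2, m2⟩
  · exact Nat.zero_le _

/-- A set that contains no two opposite elements has at most half the elements of `S`. -/
theorem two_mul_card_le (h : SignedConfig w S) {X : Finset ℤ} (hX : X ⊆ S)
    (hneg : ∀ t ∈ X, -t ∉ X) : 2 * X.card ≤ S.card := by
  classical
  have hd : Disjoint X (X.image Neg.neg) := by
    rw [Finset.disjoint_left]
    intro t ht ht'
    obtain ⟨u, hu, rfl⟩ := Finset.mem_image.1 ht'
    exact hneg u hu ht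
  have hc : (X.image Neg.neg).card = X.card := Finset.card_image_of_injective _ neg_injective
  have hs : X ∪ X.image Neg.neg ⊆ S := by
    refine Finset.union_subset hX ?_
    intro t ht
    obtain ⟨u, hu, rfl⟩ := Finset.mem_image.1 ht
    exact h.neg_mem u (hX hu)
  have := Finset.card_le_card hs
  rw [Finset.card_union_of_disjoint hd] at this
  omega

end SignedConfig

/-! ### The tight configuration around a longest free pair. -/

/-- The extremal situation in which a longest free edge `p, q` has as many incident edges as is
conceivable. The nonsymmetric free pairs span at most `p - q`. -/
structure TightConfig (w : ℤ → ℤ) (S : Finset ℤ) (p q r : ℤ) : Prop extends SignedConfig w S where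
  hp : p ∈ S
  hq : q ∈ S
  hr : r ∈ S
  p_pos : 0 < p
  wp_pos : 0 < w p
  q_neg : q < 0
  neg_p_lt_q : -p < q
  wp_lt_wq : w p < w q
  q_lt_r : q < r
  r_lt_p : r < p
  wq_lt_wr : w q < w r
  free_p_neg_p : FreePair w S p (-p)
  free_p_q : FreePair w S p q
  free_p_neg_q : FreePair w S p (-q)
  free_p_r : FreePair w S p r
  free_q_r : FreePair w S q r
  common : ∀ k ∈ S, FreePair w S p k → FreePair w S q k → k = -p ∨ k = -q ∨ k = r
  covered : ∀ k ∈ S, FreePair w S p k ∨ FreePair w S q k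
  longest : ∀ i ∈ S, ∀ j ∈ S, FreePair w S i j → j ≠ -i → |i - j| ≤ p - q
  full : S.card < 2 * (freeNbrs w S p).card

namespace TightConfig

variable {w : ℤ → ℤ} {S : Finset ℤ} {p q r s t : ℤ}

/-- The free pair `p, -p` excludes values of absolute value below `w p`. If `|w s|` were between `w
p` and `w q`, then `s` or `-s` would block `p, q` or `p, -q`. -/
theorem abs_value_gt (h : TightConfig w S p q r) (hs : s ∈ S) (h1 : -p < s) (h2 : s < p)
    (h3 : s ≠ q) (h4 : s ≠ -q) : w q < w s ∨ w s < -w q := by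
  have a1 := h.free_p_q.not_blocks hs
  have a2 := h.free_p_q.not_blocks (h.neg_mem s hs)
  have a3 := h.free_p_neg_q.not_blocks hs
  have a4 := h.free_p_neg_q.not_blocks (h.neg_mem s hs)
  have a5 := h.free_p_neg_p.not_blocks hs
  have o1 := h.odd s
  have o2 := h.odd q
  have o3 := h.odd p
  have n1 := h.map_ne h3
  have n2 := h.map_ne_neg h4
  have n3 : w s ≠ w p := h.map_ne (by omega)
  have n4 : w s ≠ -w p := h.map_ne_neg (by omega)
  have := h.wp_pos
  have := h.p_pos
  have := h.wp_lt_wq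
  have := h.q_neg
  rw [o1] at a2 a4
  rw [o2] at a3 a4
  rw [o3] at a5
  omega

/-- Maximality applied to both pairs gives `|s| ≤ -q`. Of `s` and `-s`, take the one whose value is
below `-w q`: at a negative position its pair with `p` is blocked by the origin, at a positive one
by `-q`. -/
theorem not_double_p (h : TightConfig w S p q r) (hs : s ∈ S) (h1 : s ≠ p) (h2 : s ≠ -p)
    (h3 : s ≠ q) (h4 : s ≠ -q) (hf : FreePair w S p s) : ¬ FreePair w S p (-s) := by
  intro hf'
  have hns := h.neg_mem s hs
  have l1 := h.longest p h.hp s hs hf h2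
  have l2 := h.longest p h.hp (-s) hns hf' (by omega)
  have hq := h.q_neg
  have hpq := h.neg_p_lt_q
  rw [abs_le] at l1 l2
  have hv := h.abs_value_gt hs (by omega) (by omega) h3 h4
  have c1 := h.not_central hf h2
  have c2 := h.not_central hf' (by omega)
  have b1 := hf.not_blocks h.hq
  have b2 := hf.not_blocks (h.neg_mem q h.hq)
  have b3 := hf'.not_blocks h.hq
  have b4 := hf'.not_blocks (h.neg_mem q h.hq)
  have o1 := h.odd s
  have o2 := h.odd q
  rw [o1] at b3 b4 c2
  rw [o2] at b2 b4
  have := h.wp_pos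
  have := h.p_pos
  have := h.wp_lt_wq
  have := h.ne_zero hs
  omega

theorem card_sdiff_pq (h : TightConfig w S p q r) :
    ((S \ {p, -p}) \ {q, -q}).card + 4 = S.card := by
  have h1 := h.card_erase_pair h.hp
  have hq : q ∈ S \ {p, -p} := by
    have := h.q_neg
    have := h.neg_p_lt_q
    simp only [Finset.mem_sdiff, Finset.mem_insert, Finset.mem_singleton]
    exact ⟨h.hq, by omega⟩
  have h2 := (h.erase_pair p).card_erase_pair hq
  omega

/-- With `|S| = 2n`, the neighbours of `p` are at most `-p, q, -q` and one from each of the other `n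
- 2` pairs. If a pair contributed none, there would be at most `n` in all, against `full`. -/
theorem free_p_or (h : TightConfig w S p q r) (hs : s ∈ S) (h1 : s ≠ p) (h2 : s ≠ -p)
    (h3 : s ≠ q) (h4 : s ≠ -q) : FreePair w S p s ∨ FreePair w S p (-s) := by
  by_contra hcon
  rw [not_or] at hcon
  set T := (S \ {p, -p}) \ {q, -q} with hT
  have hTc : SignedConfig w T := (h.erase_pair p).erase_pair q
  have hsT : s ∈ T := by simp [hT, hs, h1, h2, h3, h4]
  set M := freeNbrs w S p \ {-p, q, -q} with hM
  have hMsub : M ⊆ T \ {s, -s} := by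
    intro t ht
    simp only [hM, Finset.mem_sdiff, mem_freeNbrs, Finset.mem_insert, Finset.mem_singleton,
      not_or] at ht
    obtain ⟨⟨htS, hft⟩, t1, t2, t3⟩ := ht
    have tp : t ≠ p := hft.1.symm
    have ts : t ≠ s := fun e => hcon.1 (e ▸ hft)
    have ts' : t ≠ -s := fun e => hcon.2 (e ▸ hft)
    simp [hT, htS, tp, t1, t2, t3, ts, ts']
  have hMneg : ∀ t ∈ M, -t ∉ M := by
    intro t ht ht'
    simp only [hM, Finset.mem_sdiff, mem_freeNbrs, Finset.mem_insert, Finset.mem_singleton,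
      not_or] at ht ht'
    exact h.not_double_p ht.1.1 ht.1.2.1.symm ht.2.1 ht.2.2.1 ht.2.2.2 ht.1.2 ht'.1.2
  have e1 := (hTc.erase_pair s).two_mul_card_le hMsub hMneg
  have e2 := hTc.card_erase_pair hsT
  have e3 := h.card_sdiff_pq
  rw [← hT] at e3
  have e4 : (freeNbrs w S p).card ≤ M.card + 3 := by
    have := Finset.le_card_sdiff ({-p, q, -q} : Finset ℤ) (freeNbrs w S p)
    rw [← hM] at this
    have := Finset.card_le_three (a := -p) (b := q) (c := -q)
    omega
  have := h.full
  omega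

theorem r_ne (h : TightConfig w S p q r) : r ≠ p ∧ r ≠ -p ∧ r ≠ q ∧ r ≠ -q := by
  have := h.q_lt_r
  have := h.r_lt_p
  have := h.neg_p_lt_q
  refine ⟨by omega, by omega, by omega, ?_⟩
  intro e
  have h1 := h.wq_lt_wr
  have := h.wp_lt_wq
  have := h.wp_pos
  rw [e, h.odd] at h1
  omega

theorem not_free_p_neg_r (h : TightConfig w S p q r) : ¬ FreePair w S p (-r) :=
  h.not_double_p h.hr h.r_ne.1 h.r_ne.2.1 h.r_ne.2.2.1 h.r_ne.2.2.2 h.free_p_r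

theorem free_q_neg_r (h : TightConfig w S p q r) : FreePair w S q (-r) :=
  (h.covered _ (h.neg_mem r h.hr)).resolve_left h.not_free_p_neg_r

/-- Since `w q > 0 > w (-r)` and `q < 0`, a negative `r` would let the origin block the free pair
`q, -r`. -/
theorem r_pos (h : TightConfig w S p q r) : 0 < r := by
  have c := h.not_central h.free_q_neg_r (by have := h.r_ne; omega)
  have := h.q_neg
  have := h.ne_zero h.hr
  have := h.wp_pos
  have := h.wp_lt_wq
  have := h.wq_lt_wr
  rw [h.odd] at c
  omega

/-- The positions other than `±p, ±q, ±r`, up to sign: those that form a free pair with `p`. -/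
structure Other (w : ℤ → ℤ) (S : Finset ℤ) (p q r s : ℤ) : Prop where
  mem : s ∈ S
  ne_neg_p : s ≠ -p
  ne_q : s ≠ q
  ne_neg_q : s ≠ -q
  ne_r : s ≠ r
  ne_neg_r : s ≠ -r
  free_p : FreePair w S p s

theorem Other.ne_p (ho : Other w S p q r s) : s ≠ p := ho.free_p.1.symm

theorem Other.not_free_q (h : TightConfig w S p q r) (ho : Other w S p q r s) :
    ¬ FreePair w S q s := by
  intro hf
  rcases h.common s ho.mem ho.free_p hf with e | e | e
  · exact ho.ne_neg_p e
  · exact ho.ne_neg_q e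
  · exact ho.ne_r e

theorem Other.not_free_p_neg (h : TightConfig w S p q r) (ho : Other w S p q r s) :
    ¬ FreePair w S p (-s) :=
  h.not_double_p ho.mem ho.ne_p ho.ne_neg_p ho.ne_q ho.ne_neg_q ho.free_p

theorem Other.free_q_neg (h : TightConfig w S p q r) (ho : Other w S p q r s) :
    FreePair w S q (-s) :=
  (h.covered _ (h.neg_mem s ho.mem)).resolve_left (ho.not_free_p_neg h)

theorem other_or (h : TightConfig w S p q r) (hs : s ∈ S) (h1 : s ≠ p) (h2 : s ≠ -p)
    (h3 : s ≠ q) (h4 : s ≠ -q) (h5 : s ≠ r) (h6 : s ≠ -r) :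
    Other w S p q r s ∨ Other w S p q r (-s) := by
  refine (h.free_p_or hs h1 h2 h3 h4).imp (fun hf => ⟨hs, h2, h3, h4, h5, h6, hf⟩) (fun hf => ?_)
  exact ⟨h.neg_mem s hs, by omega, by omega, by omega, by omega, by omega, hf⟩

/-- To the right of `p`, the free pair `q, -s` must avoid `-p`, which puts `w s` below `w p`. To the
left, `abs_value_gt` leaves two ranges of values: in the high one the points `q, r` and the free
pairs `p, r` and `q, r` push `s` beyond `r` in both coordinates; in the low one the origin and `-q`
push `s` beyond `-q`. -/
theorem Other.cases (h : TightConfig w S p q r) (ho : Other w S p q r s) :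
    (p < s ∧ w s < w p) ∨ (r < s ∧ s < p ∧ w r < w s) ∨ (-q < s ∧ s < p ∧ w s < -w q) := by
  have hq := h.q_neg
  have hpq := h.neg_p_lt_q
  have hpp := h.p_pos
  have v1 := h.wp_pos
  have v2 := h.wp_lt_wq
  have v3 := h.wq_lt_wr
  have l1 := h.longest p h.hp s ho.mem ho.free_p ho.ne_neg_p
  rw [abs_le] at l1
  have hsp := ho.ne_p
  have hwsp := h.map_ne hsp
  rcases lt_or_gt_of_ne hsp with hlt | hgt
  · right
    have hv := h.abs_value_gt ho.mem (by omega) hlt ho.ne_q ho.ne_neg_q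
    rcases hv with hv | hv
    · left
      have b1 := ho.free_p.not_blocks h.hq
      have b2 := ho.free_p.not_blocks h.hr
      have b3 := h.free_p_r.not_blocks ho.mem
      have b4 := h.free_q_r.not_blocks ho.mem
      have := h.r_lt_p
      have := h.q_lt_r
      have := ho.ne_q
      have := ho.ne_r
      have := h.map_ne ho.ne_r
      omega
    · right
      have c1 := h.not_central ho.free_p ho.ne_neg_p
      have b1 := ho.free_p.not_blocks (h.neg_mem q h.hq)
      rw [h.odd] at b1
      have := h.ne_zero ho.mem
      have := ho.ne_neg_q
      omega
  · left
    have b := (ho.free_q_neg h).not_blocks (h.neg_mem p h.hp)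
    rw [h.odd, h.odd] at b
    omega

/-- For two low positions `s < t`, the free pair `p, s` forces `w t < w s`, and then `-s` blocks `q,
-t`. -/
theorem Other.low_unique (h : TightConfig w S p q r) (hs : Other w S p q r s)
    (ht : Other w S p q r t) (s1 : -q < s) (s2 : s < p) (s3 : w s < -w q)
    (t1 : -q < t) (t2 : t < p) (t3 : w t < -w q) : s = t := by
  by_contra hst
  have b1 := hs.free_p.not_blocks ht.mem
  have b2 := ht.free_p.not_blocks hs.mem
  have b3 := (hs.free_q_neg h).not_blocks (h.neg_mem t ht.mem)
  have b4 := (ht.free_q_neg h).not_blocks (h.neg_mem s hs.mem)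
  have o1 := h.odd s
  have o2 := h.odd t
  have := h.map_ne hst
  have := h.wp_pos
  have := h.wp_lt_wq
  omega

/-- This is where five pairs are needed: besides `±p, ±q, ±r` two pairs remain, and at most one of
them is low. -/
theorem exists_other_not_low (h : TightConfig w S p q r) (hS : 10 ≤ S.card) :
    ∃ s, Other w S p q r s ∧ ¬ (-q < s ∧ s < p ∧ w s < -w q) := by
  by_contra hcon
  push Not at hcon
  set T := ((S \ {p, -p}) \ {q, -q}) \ {r, -r} with hT
  have hTc : SignedConfig w T := ((h.erase_pair p).erase_pair q).erase_pair r
  have hrT : r ∈ (S \ {p, -p}) \ {q, -q} := by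
    have := h.r_ne
    simp [h.hr, this]
  have e1 := ((h.erase_pair p).erase_pair q).card_erase_pair hrT
  have e2 := h.card_sdiff_pq
  rw [← hT] at e1
  have pick : ∀ s ∈ T, Other w S p q r s ∨ Other w S p q r (-s) := by
    intro s hs
    simp only [hT, Finset.mem_sdiff, Finset.mem_insert, Finset.mem_singleton, not_or] at hs
    obtain ⟨⟨⟨a, b, c⟩, d, e⟩, f, g⟩ := hs
    exact h.other_or a b c d e f g
  obtain ⟨s, hs⟩ : T.Nonempty := Finset.card_pos.1 (by omega)
  have e3 := hTc.card_erase_pair hs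
  obtain ⟨t, ht⟩ : (T \ {s, -s}).Nonempty := Finset.card_pos.1 (by omega)
  simp only [Finset.mem_sdiff, Finset.mem_insert, Finset.mem_singleton, not_or] at ht
  have uniq : ∀ a b, Other w S p q r a → Other w S p q r b → a = b := by
    intro a b ha hb
    obtain ⟨a1, a2, a3⟩ := hcon a ha
    obtain ⟨b1, b2, b3⟩ := hcon b hb
    exact ha.low_unique h hb a1 a2 a3 b1 b2 b3
  rcases pick s hs with c | c <;> rcases pick t ht.1 with d | d <;>
    have := uniq _ _ c d <;> omega

/-- Apart from `u`, the neighbours of `s` lie outside `±s` and contain no opposite elements, so they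
number at most `n - 1` when `|S| = 2n`. Thus one exceptional pair, either `±u` or `±s` itself, is
affordable. -/
theorem card_freeNbrs_le (h : TightConfig w S p q r) (hs : s ∈ S) (u : ℤ)
    (hu : ∀ t ∈ S, t ≠ u → t ≠ -u → t ≠ s → t ≠ -s → FreePair w S s t → ¬ FreePair w S s (-t))
    (hus : FreePair w S s (-s) → u = -s) :
    2 * (freeNbrs w S s).card ≤ S.card := by
  classical
  have hsub : (freeNbrs w S s).erase u ⊆ S \ {s, -s} := by
    intro t ht
    simp only [Finset.mem_erase, mem_freeNbrs] at ht
    simp only [Finset.mem_sdiff, Finset.mem_insert, Finset.mem_singleton, not_or]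
    refine ⟨ht.2.1, ht.2.2.1.symm, ?_⟩
    rintro rfl
    exact ht.1 (hus ht.2.2).symm
  have hneg : ∀ t ∈ (freeNbrs w S s).erase u, -t ∉ (freeNbrs w S s).erase u := by
    intro t ht ht'
    have m1 := hsub ht
    have m2 := hsub ht'
    simp only [Finset.mem_sdiff, Finset.mem_insert, Finset.mem_singleton, not_or] at m1 m2
    simp only [Finset.mem_erase, mem_freeNbrs] at ht ht'
    exact hu t m1.1 ht.1 (by omega) m1.2.1 m1.2.2 ht.2.2 ht'.2.2
  have e1 := (h.erase_pair s).two_mul_card_le hsub hneg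
  have e2 := h.card_erase_pair hs
  have e3 := Finset.pred_card_le_card_erase (s := freeNbrs w S s) (a := u)
  omega

/-- A property of `±t` holds for all `t` if it holds for `p, q, r` and the others. -/
theorem forall_pair (h : TightConfig w S p q r) {P : ℤ → Prop} (hneg : ∀ t, P (-t) → P t)
    (hPp : P p) (hPq : P q) (hPr : P r) (hPo : ∀ t, Other w S p q r t → P t)
    (ht : t ∈ S) : P t := by
  have hneg' : ∀ t u, t = -u → P u → P t := fun t u e hu => by
    subst e
    exact hneg _ (by simpa using hu)
  by_cases h1 : t = p
  · exact h1 ▸ hPp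
  by_cases h2 : t = -p
  · exact hneg' _ _ h2 hPp
  by_cases h3 : t = q
  · exact h3 ▸ hPq
  by_cases h4 : t = -q
  · exact hneg' _ _ h4 hPq
  by_cases h5 : t = r
  · exact h5 ▸ hPr
  by_cases h6 : t = -r
  · exact hneg' _ _ h6 hPr
  rcases h.other_or ht h1 h2 h3 h4 h5 h6 with ho | ho
  · exact hPo t ho
  · exact hneg _ (hPo _ ho)

theorem Other.not_double_pq (h : TightConfig w S p q r) (ho : Other w S p q r s) :
    ¬ (FreePair w S s p ∧ FreePair w S s (-p)) ∧ ¬ (FreePair w S s q ∧ FreePair w S s (-q)) :=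
  ⟨fun hf => ho.not_free_p_neg h (h.freePair_neg_left.1 hf.2.symm),
    fun hf => ho.not_free_q h hf.1.symm⟩

/-- Here `p` blocks one of `s, t` and `s, -t` whenever `t` is `r`, upper or low. If `t` is also to
the right of `p`, then `q` or `-q` blocks `s, -t`, unless both values exceed `-w q`; in that range
the free pairs with `p` and `q` order `w s` and `w t` in contradictory ways. -/
theorem Other.card_freeNbrs_le_of_right (h : TightConfig w S p q r) (ho : Other w S p q r s)
    (s1 : p < s) (s2 : w s < w p) : 2 * (freeNbrs w S s).card ≤ S.card := by
  have hq := h.q_neg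
  have hpq := h.neg_p_lt_q
  have hpp := h.p_pos
  have v1 := h.wp_pos
  have v2 := h.wp_lt_wq
  have v3 := h.wq_lt_wr
  have hrp := h.r_lt_p
  have os := h.odd s
  have oq := h.odd q
  refine h.card_freeNbrs_le ho.mem (-s) ?_ (fun _ => rfl)
  intro t ht _ _ ts ts'
  suffices t ≠ s → t ≠ -s → ¬ (FreePair w S s t ∧ FreePair w S s (-t)) from
    fun a b => this ts ts' ⟨a, b⟩
  clear ts ts'
  refine h.forall_pair (P := fun t => t ≠ s → t ≠ -s → ¬ (FreePair w S s t ∧ FreePair w S s (-t)))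
    ?_ ?_ ?_ ?_ ?_ ht
  · intro t hP a b hf
    exact hP (by omega) (by omega) ⟨hf.2, by simpa using hf.1⟩
  · exact fun _ _ => (ho.not_double_pq h).1
  · exact fun _ _ => (ho.not_double_pq h).2
  · rintro _ _ ⟨hf, -⟩
    have := hf.not_blocks h.hp
    omega
  · rintro t hto ts ts' ⟨hf, hf'⟩
    have ot := h.odd t
    have b1 := hf.not_blocks h.hp
    have b2 := hf'.not_blocks h.hp
    rcases hto.cases h with ⟨t1, t2⟩ | ⟨t1, t2, t3⟩ | ⟨t1, t2, t3⟩
    · have b3 := hf'.not_blocks h.hq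
      have b4 := hf'.not_blocks (h.neg_mem q h.hq)
      have b5 := ho.free_p.not_blocks hto.mem
      have b6 := hto.free_p.not_blocks ho.mem
      have b7 := (ho.free_q_neg h).not_blocks (h.neg_mem t hto.mem)
      have b8 := (hto.free_q_neg h).not_blocks (h.neg_mem s ho.mem)
      have := h.map_ne ts
      have := h.map_ne hto.ne_q
      have := h.map_ne_neg hto.ne_neg_q
      have := h.map_ne ho.ne_q
      have := h.map_ne_neg ho.ne_neg_q
      clear b1 b2
      rw [ot] at b3 b4 b7 b8
      rw [os] at b7 b8
      rw [oq] at b4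
      by_cases k1 : w t < - w q
      · clear b5 b6 b7 b8; omega
      · by_cases k2 : w s < - w q
        · clear b5 b6 b7 b8; omega
        · clear b3 b4; omega
    · omega
    · omega

/-- The origin blocks `s, -t` when `t` is `r` or another upper position, and `p` blocks `s, t` when
`t` is to the right of `p`. The unique low position, if any, takes the role of the exception `u`. -/
theorem Other.card_freeNbrs_le_of_upper (h : TightConfig w S p q r) (ho : Other w S p q r s)
    (s1 : r < s) (s2 : s < p) (s3 : w r < w s) : 2 * (freeNbrs w S s).card ≤ S.card := by
  have hr0 := h.r_pos
  have hq := h.q_neg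
  have hpq := h.neg_p_lt_q
  have hpp := h.p_pos
  have v1 := h.wp_pos
  have v2 := h.wp_lt_wq
  have v3 := h.wq_lt_wr
  have hrp := h.r_lt_p
  have os := h.odd s
  have orr := h.odd r
  -- Without a low position, the condition on `u` is vacuous and 0 is an arbitrary choice.
  obtain ⟨u, hu⟩ : ∃ u, ∀ t, Other w S p q r t → -q < t → t < p → w t < -w q → t = u := by
    by_cases hex : ∃ u, Other w S p q r u ∧ -q < u ∧ u < p ∧ w u < -w q
    · obtain ⟨u, hu, u1, u2, u3⟩ := hex
      exact ⟨u, fun t ht t1 t2 t3 => ht.low_unique h hu t1 t2 t3 u1 u2 u3⟩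
    · exact ⟨0, fun t ht t1 t2 t3 => absurd ⟨t, ht, t1, t2, t3⟩ hex⟩
  refine h.card_freeNbrs_le ho.mem u ?_ ?_
  · intro t ht tu tu' ts ts'
    suffices t ≠ u → t ≠ -u → t ≠ s → t ≠ -s → ¬ (FreePair w S s t ∧ FreePair w S s (-t)) from
      fun a b => this tu tu' ts ts' ⟨a, b⟩
    clear ts ts' tu tu'
    refine h.forall_pair (P := fun t => t ≠ u → t ≠ -u → t ≠ s → t ≠ -s →
      ¬ (FreePair w S s t ∧ FreePair w S s (-t))) ?_ ?_ ?_ ?_ ?_ ht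
    · intro t hP a b c d hf
      exact hP (by omega) (by omega) (by omega) (by omega) ⟨hf.2, by simpa using hf.1⟩
    · exact fun _ _ _ _ => (ho.not_double_pq h).1
    · exact fun _ _ _ _ => (ho.not_double_pq h).2
    · rintro _ _ hrs _ ⟨-, hf'⟩
      have := h.not_central hf' (by omega)
      omega
    · rintro t hto tu tu' ts ts' ⟨hf, hf'⟩
      have ot := h.odd t
      have b1 := hf.not_blocks h.hp
      have c2 := h.not_central hf' (by omega)
      rcases hto.cases h with ⟨t1, t2⟩ | ⟨t1, t2, t3⟩ | ⟨t1, t2, t3⟩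
      · omega
      · omega
      · exact tu (hu t hto t1 t2 t3)
  -- The point `r` blocks `s, -s`, so this pair consumes no exception.
  · intro hf
    have := hf.not_blocks h.hr
    omega

theorem exists_card_freeNbrs_le (h : TightConfig w S p q r) (hS : 10 ≤ S.card) :
    ∃ s ∈ S, 2 * (freeNbrs w S s).card ≤ S.card := by
  obtain ⟨s, ho, hl⟩ := h.exists_other_not_low hS
  refine ⟨s, ho.mem, ?_⟩
  rcases ho.cases h with ⟨s1, s2⟩ | ⟨s1, s2, s3⟩ | hs
  · exact ho.card_freeNbrs_le_of_right h s1 s2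
  · exact ho.card_freeNbrs_le_of_upper h s1 s2 s3
  · exact absurd hs hl

end TightConfig

/-! ### Existence of positions with few incident edges. -/

namespace SignedConfig

variable {w : ℤ → ℤ} {S : Finset ℤ}

/-- Of two such points, the one with the smaller value lies horizontally between the other and one
of `p, q`, and blocks that pair. -/
theorem eq_of_common_above (h : SignedConfig w S) {p q k l : ℤ} (hk : k ∈ S) (hl : l ∈ S)
    (pk : FreePair w S p k) (qk : FreePair w S q k) (pl : FreePair w S p l)
    (ql : FreePair w S q l) (k1 : q < k) (k2 : k < p) (k3 : w p < w k) (k4 : w q < w k)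
    (l1 : q < l) (l2 : l < p) (l3 : w p < w l) (l4 : w q < w l) : k = l := by
  by_contra hkl
  have := pk.not_blocks hl
  have := qk.not_blocks hl
  have := pl.not_blocks hk
  have := ql.not_blocks hk
  have := h.map_ne hkl
  omega

theorem eq_of_common_below (h : SignedConfig w S) {p q k l : ℤ} (hk : k ∈ S) (hl : l ∈ S)
    (pk : FreePair w S p k) (qk : FreePair w S q k) (pl : FreePair w S p l)
    (ql : FreePair w S q l) (k1 : q < k) (k2 : k < p) (k3 : w k < w p) (k4 : w k < w q)
    (l1 : q < l) (l2 : l < p) (l3 : w l < w p) (l4 : w l < w q) : k = l := by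
  by_contra hkl
  have := pk.not_blocks hl
  have := qk.not_blocks hl
  have := pl.not_blocks hk
  have := ql.not_blocks hk
  have := h.map_ne hkl
  omega

/-- If `p, q` is a longest nonsymmetric free pair on opposite sides of the origin and `p, -p` is
free, then `p, -q` is free as well. -/
theorem freePair_neg_right_of_longest (h : SignedConfig w S) {p q : ℤ} (hp : p ∈ S) (hq : q ∈ S)
    (q_neg : q < 0) (hqp : -p < q) (wp_pos : 0 < w p) (hf : FreePair w S p q)
    (hpp : FreePair w S p (-p))
    (hmax : ∀ i ∈ S, ∀ j ∈ S, FreePair w S i j → j ≠ -i → |i - j| ≤ p - q) :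
    FreePair w S p (-q) := by
  classical
  by_contra hcon
  have oq := h.odd q
  have op := h.odd p
  have hwq : w p < w q := by
    have b := hpp.not_blocks hq
    have b' := hpp.not_blocks (h.neg_mem q hq)
    have c := h.not_central hf (by omega)
    have := h.map_ne hf.1
    have := h.map_ne_zero hq
    omega
  rw [← h.freePair_neg_left, freePair_comm, FreePair] at hcon
  have hne : ((S.filter fun k => Blocks w q (-p) k)).Nonempty := by
    rw [Finset.filter_nonempty_iff]
    by_contra hno
    push Not at hno
    refine hcon ⟨by omega, hno, Or.inr ?_⟩
    simp only [Blocks, StrictBtw]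
    omega
  -- The lowest blocker `k` of `q, -p` satisfies `w p < w k < w q`. A blocker of `p, k` would either
  -- block `p, q` or be a lower blocker of `q, -p`. So `p, k` is free, and it is longer than `p, q`
  -- because `k < q`.
  obtain ⟨k, hk, hmin⟩ := Finset.exists_min_image _ w hne
  simp only [Finset.mem_filter] at hk hmin
  obtain ⟨hkS, hkb⟩ := hk
  simp only [Blocks, StrictBtw, op] at hkb hmin
  have b := hpp.not_blocks hkS
  have wkp : w k ≠ w p := h.map_ne (by omega)
  have wkp' : w k ≠ -w p := h.map_ne_neg (by omega)
  have hpk : FreePair w S p k := by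
    refine ⟨by omega, ?_, Or.inr ?_⟩
    · intro z hz hzb
      simp only [Blocks, StrictBtw] at hzb
      have b2 := hf.not_blocks hz
      have hzq : z ≠ q := by
        rintro rfl
        omega
      have := hmin z
      by_cases hlt : z < q
      · have := hmin z ⟨hz, by omega⟩
        omega
      · omega
    · simp only [Blocks, StrictBtw, h.map_zero]
      omega
  have := hmax p hp k hkS hpk (by omega)
  rw [abs_le] at this
  omega

/-- The bound `hpair` demands at least two common neighbours of `p` and `q`, three if `p, -q` is
free. Position and value leave room for no more than that, so every inequality is an equality: every
position of `S` is a neighbour of `p` or `q`. -/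
theorem false_of_longest (h : SignedConfig w S) (hS : 10 ≤ S.card)
    (hdeg : ∀ s ∈ S, S.card < 2 * (freeNbrs w S s).card)
    {p q : ℤ} (hp : p ∈ S) (hq : q ∈ S) (hp0 : 0 < p) (wp_pos : 0 < w p)
    (hqp : -p < q) (hqp' : q < p) (hf : FreePair w S p q)
    (hmax : ∀ i ∈ S, ∀ j ∈ S, FreePair w S i j → j ≠ -i → |i - j| ≤ p - q)
    (hpair : S.card + 1 + (if FreePair w S p (-q) then 1 else 0)
      < (freeNbrs w S p).card + (freeNbrs w S q).card) : False := by
  classical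
  have hq0 := h.ne_zero hq
  have oq := h.odd q
  have op := h.odd p
  have hnp := h.neg_mem p hp
  have hnq := h.neg_mem q hq
  set C := freeNbrs w S p ∩ freeNbrs w S q with hC
  have hUS : freeNbrs w S p ∪ freeNbrs w S q ⊆ S :=
    Finset.union_subset (Finset.filter_subset _ _) (Finset.filter_subset _ _)
  have hU := Finset.card_le_card hUS
  have hUC := Finset.card_union_add_card_inter (freeNbrs w S p) (freeNbrs w S q)
  rw [← hC] at hUC
  have memC : ∀ k, k ∈ C ↔ k ∈ S ∧ FreePair w S p k ∧ FreePair w S q k := by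
    intro k
    rw [hC, Finset.mem_inter, mem_freeNbrs, mem_freeNbrs]
    tauto
  set Ca := C.filter fun k => q < k ∧ k < p ∧ w p < w k ∧ w q < w k with hCa
  set Cb := C.filter fun k => q < k ∧ k < p ∧ w k < w p ∧ w k < w q with hCb
  have cCa : Ca.card ≤ 1 := by
    rw [Finset.card_le_one]
    intro k hk l hl
    simp only [hCa, Finset.mem_filter, memC] at hk hl
    obtain ⟨⟨k1, k2, k3⟩, k4, k5, k6, k7⟩ := hk
    obtain ⟨⟨l1, l2, l3⟩, l4, l5, l6, l7⟩ := hl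
    exact h.eq_of_common_above k1 l1 k2 k3 l2 l3 k4 k5 k6 k7 l4 l5 l6 l7
  have cCb : Cb.card ≤ 1 := by
    rw [Finset.card_le_one]
    intro k hk l hl
    simp only [hCb, Finset.mem_filter, memC] at hk hl
    obtain ⟨⟨k1, k2, k3⟩, k4, k5, k6, k7⟩ := hk
    obtain ⟨⟨l1, l2, l3⟩, l4, l5, l6, l7⟩ := hl
    exact h.eq_of_common_below k1 l1 k2 k3 l2 l3 k4 k5 k6 k7 l4 l5 l6 l7
  have split : ∀ k ∈ C, q < k → k < p → k ∈ Ca ∨ k ∈ Cb := by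
    intro k hk k1 k2
    have hk' := (memC k).1 hk
    have b := hf.not_blocks hk'.1
    have n1 : w k ≠ w p := h.map_ne (by omega)
    have n2 : w k ≠ w q := h.map_ne (by omega)
    simp only [hCa, hCb, Finset.mem_filter, hk, true_and]
    omega
  -- A common neighbour outside the interval would form a longer free pair with `p` or with `q`.
  -- Only the symmetric pairs are exempt from maximality.
  have between : ∀ k ∈ C, k ≠ -p → k ≠ -q → q < k ∧ k < p := by
    intro k hk k1 k2
    obtain ⟨hkS, hpk, hqk⟩ := (memC k).1 hk
    have m1 := hmax p hp k hkS hpk k1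
    have m2 := hmax q hq k hkS hqk k2
    have := hpk.1
    have := hqk.1
    rw [abs_le] at m1 m2
    omega
  have full_of : S.card ≤ (freeNbrs w S p ∪ freeNbrs w S q).card →
      ∀ k ∈ S, FreePair w S p k ∨ FreePair w S q k := by
    intro hc k hk
    rw [← Finset.eq_of_subset_of_card_le hUS hc, Finset.mem_union, mem_freeNbrs,
      mem_freeNbrs] at hk
    tauto
  by_cases hfq : FreePair w S p (-q)
  · rw [if_pos hfq] at hpair
    have hq_neg : q < 0 := by
      have := hmax p hp (-q) hnq hfq (by omega)
      rw [abs_le] at this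
      omega
    -- Since `q < 0` and `-p < q`, the position `-q` also lies between `q` and `p`, so only `-p`
    -- needs to be added.
    have hsub : C ⊆ insert (-p) (Ca ∪ Cb) := by
      intro k hk
      rw [Finset.mem_insert, Finset.mem_union]
      by_cases k1 : k = -p
      · exact Or.inl k1
      · refine Or.inr (split k hk ?_ ?_)
        · by_cases k2 : k = -q
          · omega
          · exact (between k hk k1 k2).1
        · by_cases k2 : k = -q
          · omega
          · exact (between k hk k1 k2).2
    have c1 := Finset.card_le_card hsub
    have c2 := Finset.card_insert_le (-p) (Ca ∪ Cb)
    have c3 := Finset.card_union_le Ca Cb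
    have hpC : -p ∈ C := by
      by_contra hno
      have : C ⊆ Ca ∪ Cb := fun k hk =>
        (Finset.mem_insert.1 (hsub hk)).resolve_left (fun e => hno (e ▸ hk))
      have := Finset.card_le_card this
      omega
    have hpp := ((memC _).1 hpC).2.1
    have hCa1 : 0 < Ca.card := by omega
    obtain ⟨r, hr⟩ := Finset.card_pos.1 hCa1
    have hr' := hr
    simp only [hCa, Finset.mem_filter, memC] at hr'
    obtain ⟨⟨hrS, hpr, hqr⟩, r1, r2, r3, r4⟩ := hr'
    have hwq : w p < w q := by
      have b := hpp.not_blocks hq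
      have c := h.not_central hf (by omega)
      have := h.map_ne hf.1
      have := h.map_ne_zero hq
      omega
    -- Because `p, -p` and `p, k` are free, `0 < k` and `w k < -w p`. Comparing such a point with
    -- `-q` in both coordinates, each of the four relative positions produces a blocker of `p, k`,
    -- `q, k`, `p, q` or `p, -q`.
    have hbelow : ∀ k ∈ Cb, k = -q := by
      intro k hk
      simp only [hCb, Finset.mem_filter, memC] at hk
      obtain ⟨⟨hkS, hpk, hqk⟩, k1, k2, k3, k4⟩ := hk
      by_contra hkq
      have hk0 := h.ne_zero hkS
      have ok := h.odd k
      have b1 := hpp.not_blocks hkS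
      have b2 := hpk.not_blocks hnq
      have b3 := hqk.not_blocks hnq
      have b4 := hfq.not_blocks hkS
      have b5 := hfq.not_blocks (h.neg_mem k hkS)
      have b6 := hf.not_blocks (h.neg_mem k hkS)
      have c1 := h.not_central hpk (by omega)
      have := h.map_ne_neg hkq
      have : w k ≠ -w p := h.map_ne_neg (by omega)
      omega
    have ht : TightConfig w S p q r :=
      { toSignedConfig := h
        hp := hp
        hq := hq
        hr := hrS
        p_pos := hp0
        wp_pos := wp_pos
        q_neg := hq_neg
        neg_p_lt_q := hqp
        wp_lt_wq := hwq
        q_lt_r := r1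
        r_lt_p := r2
        wq_lt_wr := r4
        free_p_neg_p := hpp
        free_p_q := hf
        free_p_neg_q := hfq
        free_p_r := hpr
        free_q_r := hqr
        common := by
          intro k hk hpk hqk
          have hkC := (memC k).2 ⟨hk, hpk, hqk⟩
          rcases Finset.mem_insert.1 (hsub hkC) with e | e
          · exact Or.inl e
          · rcases Finset.mem_union.1 e with e | e
            · exact Or.inr (Or.inr (Finset.card_le_one.1 cCa k e r hr))
            · exact Or.inr (Or.inl (hbelow k e))
        covered := full_of (by omega)
        longest := hmax
        full := hdeg p hp }
    obtain ⟨s, hs, hle⟩ := ht.exists_card_freeNbrs_le hS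
    exact absurd (hdeg s hs) (by omega)
  · rw [if_neg hfq] at hpair
    have hfq' : ¬ FreePair w S q (-p) := by
      rwa [freePair_comm, h.freePair_neg_left]
    have hsub : C ⊆ Ca ∪ Cb := by
      intro k hk
      have hk' := (memC k).1 hk
      obtain ⟨k1, k2⟩ := between k hk (fun e => hfq' (e ▸ hk'.2.2)) (fun e => hfq (e ▸ hk'.2.1))
      exact Finset.mem_union.2 (split k hk k1 k2)
    have c1 := Finset.card_le_card hsub
    have c3 := Finset.card_union_le Ca Cb
    have hcov := full_of (by omega)
    -- Covering makes `-p` a neighbour of `p` or `q`; the latter would make `p, -q` free by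
    -- negation.
    have hpp : FreePair w S p (-p) := (hcov _ hnp).resolve_right hfq'
    rcases lt_or_gt_of_ne hq0 with hq1 | hq1
    · exact hfq (h.freePair_neg_right_of_longest hp hq hq1 hqp wp_pos hf hpp hmax)
    · obtain ⟨a, ha⟩ := Finset.card_pos.1 (show 0 < Ca.card by omega)
      obtain ⟨b, hb⟩ := Finset.card_pos.1 (show 0 < Cb.card by omega)
      simp only [hCa, hCb, Finset.mem_filter, memC] at ha hb
      -- Here `0 < q < k`, so `p, -k` is too long to be free and covering gives `q, -k`. The origin
      -- then forces `w k` and `w q` to have opposite signs. This cannot hold both for `a` with `w a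
      -- > w q` and for `b` with `w b < w q`.
      have free_neg : ∀ k ∈ S, q < k → k < p → FreePair w S q (-k) := by
        intro k hk k1 k2
        refine (hcov _ (h.neg_mem k hk)).resolve_left fun hpk => ?_
        have := hmax p hp (-k) (h.neg_mem k hk) hpk (by omega)
        rw [abs_le] at this
        omega
      have fa := h.not_central (free_neg a ha.1.1 ha.2.1 ha.2.2.1) (by omega)
      have fb := h.not_central (free_neg b hb.1.1 hb.2.1 hb.2.2.1) (by omega)
      have := h.map_ne_zero hq
      rw [h.odd] at fa fb
      omega

/-- There is a position, or a pair of positions, with few incident free edges. -/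
theorem exists_few_edges (h : SignedConfig w S) (hS : 10 ≤ S.card) :
    (∃ p ∈ S, 2 * (freeNbrs w S p).card ≤ S.card) ∨
    (∃ p ∈ S, ∃ q ∈ S, p ≠ q ∧ p ≠ -q ∧ (freeNbrs w S p).card + (freeNbrs w S q).card
      ≤ S.card + (if FreePair w S p q then 1 else 0)
        + (if FreePair w S p (-q) then 1 else 0)) := by
  classical
  by_contra hcon
  rw [not_or] at hcon
  obtain ⟨hdeg, hpair⟩ := hcon
  push Not at hdeg hpair
  set E := (S ×ˢ S).filter fun e => FreePair w S e.1 e.2 ∧ e.2 ≠ -e.1 with hE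
  have hEne : E.Nonempty := by
    obtain ⟨p, hp⟩ : S.Nonempty := Finset.card_pos.1 (by omega)
    have := hdeg p hp
    have h1 := Finset.pred_card_le_card_erase (s := freeNbrs w S p) (a := -p)
    obtain ⟨q, hq⟩ : ((freeNbrs w S p).erase (-p)).Nonempty := Finset.card_pos.1 (by omega)
    rw [Finset.mem_erase, mem_freeNbrs] at hq
    exact ⟨(p, q), by simp [hE, hp, hq]⟩
  -- The extremal choice: horizontal length is maximised over nonsymmetric pairs only.
  obtain ⟨⟨p, q⟩, hpq, hmax⟩ := Finset.exists_max_image E (fun e => |e.1 - e.2|) hEne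
  simp only [hE, Finset.mem_filter, Finset.mem_product, Prod.forall, and_imp] at hpq hmax
  obtain ⟨⟨hp, hq⟩, hf, hne⟩ := hpq
  -- the reductions to `|q| < p` and to positive values
  have pos : ∀ p q, p ∈ S → q ∈ S → 0 < p → -p < q → q < p → FreePair w S p q →
      (∀ i ∈ S, ∀ j ∈ S, FreePair w S i j → j ≠ -i → |i - j| ≤ |p - q|) → False := by
    intro p q hp hq hp0 h1 h2 hf hmax
    have hpr := hpair p hp q hq (by omega) (by omega)
    rw [if_pos hf] at hpr
    rw [abs_of_pos (by omega : 0 < p - q)] at hmax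
    rcases lt_or_gt_of_ne (h.map_ne_zero hp) with hw | hw
    · refine h.neg_values.false_of_longest hS ?_ hp hq hp0 (by simpa using hw) h1 h2 ?_ ?_ ?_
      · simpa only [freeNbrs_neg_values] using hdeg
      · rwa [freePair_neg_values]
      · simpa only [freePair_neg_values] using hmax
      · simpa only [freePair_neg_values, freeNbrs_neg_values] using hpr
    · exact h.false_of_longest hS hdeg hp hq hp0 hw h1 h2 hf hmax hpr
  have lt_abs : ∀ p q, p ∈ S → q ∈ S → |q| < |p| → FreePair w S p q →
      (∀ i ∈ S, ∀ j ∈ S, FreePair w S i j → j ≠ -i → |i - j| ≤ |p - q|) → False := by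
    intro p q hp hq hlt hf hmax
    rcases lt_or_gt_of_ne (h.ne_zero hp) with hp0 | hp0
    · rw [abs_of_neg hp0, abs_lt] at hlt
      refine pos (-p) (-q) (h.neg_mem p hp) (h.neg_mem q hq) (by omega) (by omega) (by omega)
        (h.freePair_neg hf) ?_
      rwa [show -p - -q = -(p - q) by ring, abs_neg]
    · rw [abs_of_pos hp0, abs_lt] at hlt
      exact pos p q hp hq hp0 hlt.1 hlt.2 hf hmax
  have hmax' : ∀ i ∈ S, ∀ j ∈ S, FreePair w S i j → j ≠ -i → |i - j| ≤ |p - q| :=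
    fun i hi j hj => hmax i j hi hj
  rcases lt_trichotomy |q| |p| with hlt | heq | hgt
  · exact lt_abs p q hp hq hlt hf hmax'
  · rcases abs_eq_abs.1 heq with e | e
    · exact hf.1 e.symm
    · exact hne e
  · rw [abs_sub_comm p q] at hmax'
    exact lt_abs q p hq hp hgt hf.symm hmax'

end SignedConfig

/-! ### Small configurations, by enumeration -/

/-- `b` lies strictly between `a` and `c`, for codes of values. -/
def codeBtw (a b c : ℕ) : Bool :=
  (Nat.blt a b && Nat.blt b c) || (Nat.blt c b && Nat.blt b a)

/-- Counts the entries of the second list, other than `N`, such that no entry before it (and none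
in the first list) lies strictly between it and `v`. -/
def codeScan (N v : ℕ) : List ℕ → List ℕ → ℕ
  | _, [] => 0
  | seen, u :: us =>
    (bif !(Nat.beq u N) && seen.all (fun s => !(codeBtw v s u)) then 1 else 0)
      + codeScan N v (u :: seen) us

/-- The number of free edges that a new outermost position with code `v` creates, where `L` lists
the codes at the smaller positive positions, outermost first. The code of `0` is `N`. -/
def codeNew (N v : ℕ) (L : List ℕ) : ℕ :=
  codeScan N v [] (L ++ N :: L.reverse.map (fun s => 2 * N - s))
    + (bif L.all (fun s => !(codeBtw v s (2 * N - v)) && !(codeBtw v (2 * N - s) (2 * N - v)))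
        then 1 else 0)

def codeTotal (N : ℕ) : List ℕ → ℕ
  | [] => 0
  | v :: L => codeNew N v L + codeTotal N L

/-- `v` may be added to the list `L` of codes. -/
def codeFresh (N v : ℕ) (L : List ℕ) : Bool :=
  !(Nat.beq v N) && L.all (fun s => !(Nat.beq s v) && !(Nat.beq s (2 * N - v)))

/-- All extensions of `L` by `k` codes have at most `B` free edges in total, where `L` has `acc`. -/
def codeCheck (N B : ℕ) : ℕ → List ℕ → ℕ → Bool
  | 0, _, acc => Nat.ble acc B
  | k + 1, L, acc => (List.range (2 * N + 1)).all fun v =>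
      !(codeFresh N v L) || codeCheck N B k (v :: L) (acc + codeNew N v L)

def CodeValid (N : ℕ) : List ℕ → Prop
  | [] => True
  | v :: L => v ≤ 2 * N ∧ codeFresh N v L = true ∧ CodeValid N L

theorem CodeValid.of_append {N : ℕ} {M L : List ℕ} (h : CodeValid N (M ++ L)) :
    CodeValid N L := by
  induction M with
  | nil => exact h
  | cons v M ih => exact ih h.2.2

/-- Lists are outermost first and the search works from the inside out, so the induction peels off
the last entry of `M`, the innermost one not yet placed. -/
theorem codeTotal_le_of_codeCheck {N B : ℕ} (k : ℕ) :
    ∀ L M : List ℕ, M.length = k → CodeValid N (M ++ L) →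
      codeCheck N B k L (codeTotal N L) = true → codeTotal N (M ++ L) ≤ B := by
  induction k with
  | zero =>
    intro L M hM _ hc
    rw [List.length_eq_zero_iff.1 hM]
    exact Nat.le_of_ble_eq_true hc
  | succ k ih =>
    intro L M hM hv hc
    obtain ⟨M', v, rfl⟩ := List.eq_nil_or_concat M |>.resolve_left (by
      rintro rfl
      simp at hM)
    rw [List.concat_eq_append, List.append_assoc, List.singleton_append] at hv ⊢
    refine ih (v :: L) M' (by simpa using hM) hv ?_
    have hv' := hv.of_append
    simp only [codeCheck, List.all_eq_true, List.mem_range] at hc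
    have := hc v (Nat.lt_succ_of_le hv'.1)
    rw [hv'.2.1] at this
    rw [codeTotal, add_comm]
    simpa using this

-- The finite base: the bounds are `4(n-1)` for `n = 2, 3, 4, 5`, evaluated by the kernel.
set_option maxRecDepth 100000 in
theorem codeCheck_two : codeCheck 2 4 2 [] 0 = true := by decide +kernel

set_option maxRecDepth 100000 in
theorem codeCheck_three : codeCheck 3 8 3 [] 0 = true := by decide +kernel

set_option maxRecDepth 100000 in
theorem codeCheck_four : codeCheck 4 12 4 [] 0 = true := by decide +kernel

set_option maxRecDepth 100000 in
theorem codeCheck_five : codeCheck 5 16 5 [] 0 = true := by decide +kernel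

theorem codeBtw_iff {a b c : ℕ} :
    codeBtw a b c = true ↔ (a < b ∧ b < c) ∨ (c < b ∧ b < a) := by
  have hb : ∀ x y : ℕ, Nat.blt x y = true ↔ x < y := fun x y => by
    rw [Nat.blt, Nat.ble_eq, Nat.succ_le_iff]
  simp only [codeBtw, Bool.or_eq_true, Bool.and_eq_true, hb]

/-- A coding of the values of `w` at the positions in `S` and at `0` by natural numbers. -/
structure ValueCode (w : ℤ → ℤ) (S : Finset ℤ) (N : ℕ) (c : ℤ → ℕ) : Prop where
  lt_iff : ∀ i ∈ insert 0 S, ∀ j ∈ insert 0 S, c i < c j ↔ w i < w j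
  map_neg : ∀ i ∈ insert 0 S, c (-i) = 2 * N - c i
  map_zero : c 0 = N
  le : ∀ i ∈ insert 0 S, c i ≤ 2 * N

theorem ValueCode.mono {w : ℤ → ℤ} {S T : Finset ℤ} {N : ℕ} {c : ℤ → ℕ}
    (h : ValueCode w S N c) (hT : T ⊆ S) : ValueCode w T N c where
  lt_iff := fun i hi j hj =>
    h.lt_iff i (Finset.insert_subset_insert 0 hT hi) j (Finset.insert_subset_insert 0 hT hj)
  map_neg := fun i hi => h.map_neg i (Finset.insert_subset_insert 0 hT hi)
  map_zero := h.map_zero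
  le := fun i hi => h.le i (Finset.insert_subset_insert 0 hT hi)

theorem ValueCode.eq_iff {w : ℤ → ℤ} {S : Finset ℤ} {N : ℕ} {c : ℤ → ℕ}
    (h : ValueCode w S N c) (hS : SignedConfig w S) {i j : ℤ} (hi : i ∈ insert 0 S)
    (hj : j ∈ insert 0 S) : c i = c j ↔ i = j := by
  refine ⟨fun e => ?_, fun e => e ▸ rfl⟩
  by_contra hij
  have := hS.map_ne hij
  have := h.lt_iff i hi j hj
  have := h.lt_iff j hj i hi
  omega

theorem ValueCode.codeBtw_iff {w : ℤ → ℤ} {S : Finset ℤ} {N : ℕ} {c : ℤ → ℕ}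
    (h : ValueCode w S N c) {i j k : ℤ} (hi : i ∈ insert 0 S) (hj : j ∈ insert 0 S)
    (hk : k ∈ insert 0 S) : codeBtw (c i) (c k) (c j) = true ↔ StrictBtw (w i) (w k) (w j) := by
  rw [_root_.codeBtw_iff, h.lt_iff i hi k hk, h.lt_iff k hk j hj, h.lt_iff j hj k hk,
    h.lt_iff k hk i hi, StrictBtw]

/-- Because `Q` decreases, the entries seen before `i` are those at larger positions, hence the only
candidates to block `i` from a position to the right of the whole list. -/
theorem card_le_codeScan (N v : ℕ) (c : ℤ → ℕ) (Q : List ℤ) :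
    ∀ (seen : List ℤ) (X : Finset ℤ), Q.Pairwise (· > ·) → (∀ i ∈ X, i ∈ Q) →
      (∀ i ∈ X, c i ≠ N) → (∀ i ∈ X, ∀ k ∈ seen, ¬ codeBtw v (c k) (c i) = true) →
      (∀ i ∈ X, ∀ k ∈ Q, i < k → ¬ codeBtw v (c k) (c i) = true) →
      X.card ≤ codeScan N v (seen.map c) (Q.map c) := by
  induction Q with
  | nil =>
    intro seen X _ hX _ _ _
    have : X = ∅ := Finset.eq_empty_of_forall_notMem (fun i hi => by simpa using hX i hi)
    simp [this]
  | cons u us ih =>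
    intro seen X hQ hX hN hseen hblk
    rw [List.pairwise_cons] at hQ
    have h1 := ih (u :: seen) (X.erase u) hQ.2
      (fun i hi => (List.mem_cons.1 (hX i (Finset.mem_of_mem_erase hi))).resolve_left
        (Finset.ne_of_mem_erase hi))
      (fun i hi => hN i (Finset.mem_of_mem_erase hi))
      (by
        intro i hi k hk
        have hiX := Finset.mem_of_mem_erase hi
        rcases List.mem_cons.1 hk with rfl | hk
        · refine hblk i hiX k (by simp) (hQ.1 i ?_)
          exact (List.mem_cons.1 (hX i hiX)).resolve_left (Finset.ne_of_mem_erase hi)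
        · exact hseen i hiX k hk)
      (fun i hi k hk hik =>
        hblk i (Finset.mem_of_mem_erase hi) k (List.mem_cons_of_mem _ hk) hik)
    rw [List.map_cons, codeScan]
    rw [List.map_cons] at h1
    by_cases hu : u ∈ X
    · have hc : (!(Nat.beq (c u) N) && (seen.map c).all (fun s => !(codeBtw v s (c u)))) = true := by
        simp only [Bool.and_eq_true, Bool.not_eq_true', List.all_eq_true, List.mem_map,
          forall_exists_index, and_imp, forall_apply_eq_imp_iff₂]
        refine ⟨?_, fun k hk => by simpa using hseen u hu k hk⟩
        rw [← Bool.not_eq_true, Nat.beq_eq]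
        exact hN u hu
      rw [hc, cond_true]
      rw [Finset.card_erase_of_mem hu] at h1
      omega
    · rw [Finset.erase_eq_of_notMem hu] at h1
      omega

/-- The set of positions `±i` for `i` in a list. -/
def signedPositions (P : List ℤ) : Finset ℤ := (P ++ P.map Neg.neg).toFinset

theorem mem_signedPositions {P : List ℤ} {i : ℤ} : i ∈ signedPositions P ↔ i ∈ P ∨ -i ∈ P := by
  simp only [signedPositions, List.mem_toFinset, List.mem_append, List.mem_map]
  refine or_congr_right ⟨?_, fun h => ⟨-i, h, neg_neg i⟩⟩
  rintro ⟨a, ha, rfl⟩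
  simpa using ha

/-- An outermost position never blocks an inner pair, so edges can be charged to their outer end.
The edges charged to `p` are found by scanning leftwards through the inner positions and the origin,
with the pair `p, -p` treated apart because the origin does not block it. -/
theorem card_freeEdges_le_codeTotal {w : ℤ → ℤ} (N : ℕ) (c : ℤ → ℕ) (P : List ℤ) :
    SignedConfig w (signedPositions P) → ValueCode w (signedPositions P) N c →
      P.Pairwise (· > ·) → (∀ i ∈ P, 0 < i) →
      (freeEdges w (signedPositions P)).card ≤ codeTotal N (P.map c) ∧
        CodeValid N (P.map c) := by
  induction P with
  | nil =>
    intro _ _ _ _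
    refine ⟨?_, trivial⟩
    rw [Finset.card_eq_zero.2]
    · exact Nat.zero_le _
    · refine Finset.eq_empty_of_forall_notMem fun e he => ?_
      have := (mem_freeEdges.1 he).1.1
      simp [signedPositions] at this
  | cons p P ih =>
    intro hS hc hP hpos
    rw [List.pairwise_cons] at hP
    have hp0 := hpos p (by simp)
    have hlt : ∀ i ∈ signedPositions P, -p < i ∧ i < p := by
      intro i hi
      rcases mem_signedPositions.1 hi with h | h
      · have := hP.1 i h
        have := hpos i (by simp [h])
        omega
      · have := hP.1 _ h
        have := hpos (-i) (by simp [h])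
        omega
    have hsub : signedPositions P ⊆ signedPositions (p :: P) := by
      intro i hi
      rw [mem_signedPositions] at hi ⊢
      exact hi.imp (List.mem_cons_of_mem _) (List.mem_cons_of_mem _)
    have hmem : ∀ i, i ∈ signedPositions (p :: P) ↔ i = p ∨ i = -p ∨ i ∈ signedPositions P := by
      intro i
      simp only [mem_signedPositions, List.mem_cons]
      constructor
      · rintro ((h | h) | (h | h))
        · exact Or.inl h
        · exact Or.inr (Or.inr (Or.inl h))
        · exact Or.inr (Or.inl (by omega))
        · exact Or.inr (Or.inr (Or.inr h))
      · rintro (h | h | h | h)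
        · exact Or.inl (Or.inl h)
        · exact Or.inr (Or.inl (by omega))
        · exact Or.inl (Or.inr h)
        · exact Or.inr (Or.inr h)
    have hpS : p ∈ signedPositions (p :: P) := (hmem p).2 (Or.inl rfl)
    have hS' : SignedConfig w (signedPositions P) :=
      ⟨hS.odd, hS.inj, fun i hi => by
        rw [mem_signedPositions] at hi ⊢
        rw [neg_neg]
        exact hi.symm, fun h0 => hS.zero_notMem (hsub h0)⟩
    obtain ⟨ih1, ih2⟩ := ih hS' (hc.mono hsub) hP.2 (fun i hi => hpos i (by simp [hi]))
    have hins : ∀ i ∈ signedPositions (p :: P), i ∈ insert 0 (signedPositions (p :: P)) :=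
      fun i hi => Finset.mem_insert_of_mem hi
    have hinsP : ∀ i ∈ P, i ∈ insert 0 (signedPositions (p :: P)) :=
      fun i hi => hins i (hsub (mem_signedPositions.2 (Or.inl hi)))
    have hcneg : c (-p) = 2 * N - c p := hc.map_neg p (hins p hpS)
    have hPneg : ∀ i ∈ P, c (-i) = 2 * N - c i := fun i hi => hc.map_neg i (hinsP i hi)
    have h0ins : (0 : ℤ) ∈ insert 0 (signedPositions (p :: P)) := Finset.mem_insert_self _ _
    refine ⟨?_, hc.le p (hins p hpS), ?_, ih2⟩
    · set X := (signedPositions P).filter (FreePair w (signedPositions (p :: P)) p) with hX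
      set sy : Finset ℤ :=
        if FreePair w (signedPositions (p :: P)) p (-p) then {-p} else ∅ with hsy
      -- In a normalised edge `(i, j)`, an end `±p` forces `j = p`, since `-j ≤ i < j`.
      have hcov : freeEdges w (signedPositions (p :: P)) ⊆
          freeEdges w (signedPositions P) ∪ (X ∪ sy).image (fun i => (i, p)) := by
        rintro ⟨i, j⟩ he
        obtain ⟨⟨hi, hj⟩, h1, h2, hf⟩ := mem_freeEdges.1 he
        simp only at hi hj h1 h2 hf
        rw [hmem] at hi hj
        have hjp : j = p ∨ j ∈ signedPositions P := by
          rcases hj with h | h | h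
          · exact Or.inl h
          · omega
          · exact Or.inr h
        rcases hjp with rfl | hj
        · refine Finset.mem_union_right _ (Finset.mem_image.2 ⟨i, ?_, rfl⟩)
          rcases hi with rfl | rfl | hi
          · omega
          · refine Finset.mem_union_right _ ?_
            rw [hsy, if_pos hf.symm]
            exact Finset.mem_singleton_self _
          · exact Finset.mem_union_left _ (Finset.mem_filter.2 ⟨hi, hf.symm⟩)
        · refine Finset.mem_union_left _ (mem_freeEdges.2 ⟨⟨?_, hj⟩, h1, h2, hf.mono hsub⟩)
          have := hlt j hj
          rcases hi with rfl | rfl | hi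
          · omega
          · omega
          · exact hi
      have k1 := (Finset.card_le_card hcov).trans (Finset.card_union_le _ _)
      have k2 := Finset.card_image_le (s := X ∪ sy) (f := fun i : ℤ => (i, p))
      have k3 := Finset.card_union_le X sy
      have hX0 : ∀ i ∈ X, i ∈ signedPositions P ∧
          FreePair w (signedPositions (p :: P)) p i := fun i hi => Finset.mem_filter.1 hi
      have hQmem : ∀ i, i ∈ P ++ 0 :: P.reverse.map Neg.neg ↔ i = 0 ∨ i ∈ signedPositions P := by
        intro i
        rw [mem_signedPositions]
        simp only [List.mem_append, List.mem_cons, List.mem_map, List.mem_reverse]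
        constructor
        · rintro (h | h | ⟨a, h, rfl⟩)
          · exact Or.inr (Or.inl h)
          · exact Or.inl h
          · exact Or.inr (Or.inr (by simpa using h))
        · rintro (h | h | h)
          · exact Or.inr (Or.inl h)
          · exact Or.inl h
          · exact Or.inr (Or.inr ⟨-i, h, neg_neg i⟩)
      have hQ : (P ++ 0 :: P.reverse.map Neg.neg).Pairwise (· > ·) := by
        rw [List.pairwise_append, List.pairwise_cons, List.pairwise_map, List.pairwise_reverse]
        have hposP : ∀ i ∈ P, 0 < i := fun i hi => hpos i (by simp [hi])
        refine ⟨hP.2, ⟨?_, hP.2.imp (fun h => by omega)⟩, ?_⟩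
        · simp only [List.mem_map, List.mem_reverse]
          rintro _ ⟨a, ha, rfl⟩
          have := hposP a ha
          omega
        · simp only [List.mem_cons, List.mem_map, List.mem_reverse]
          rintro a ha _ (rfl | ⟨b, hb, rfl⟩)
          · exact hposP a ha
          · have := hposP a ha
            have := hposP b hb
            omega
      have k4 := card_le_codeScan N (c p) c _ [] X hQ
        (fun i hi => (hQmem i).2 (Or.inr (hX0 i hi).1))
        (fun i hi e => hS'.ne_zero (hX0 i hi).1
          ((hc.eq_iff hS (hins i (hsub (hX0 i hi).1)) h0ins).1 (e.trans hc.map_zero.symm)))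
        (fun i _ k hk => by simp at hk)
        (by
          intro i hi k hk hik hb
          obtain ⟨hiP, hf⟩ := hX0 i hi
          have hli := hlt i hiP
          rw [hQmem] at hk
          have hk' : k ∈ insert 0 (signedPositions (p :: P)) := by
            rcases hk with rfl | hk
            · exact h0ins
            · exact hins k (hsub hk)
          rw [hc.codeBtw_iff (hins p hpS) (hins i (hsub hiP)) hk'] at hb
          rcases hk with rfl | hk
          · exact hf.2.2.resolve_left (by omega) ⟨Or.inr ⟨hik, hp0⟩, hb⟩
          · exact hf.2.1 k (hsub hk) ⟨Or.inr ⟨hik, (hlt k hk).2⟩, hb⟩)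
      have k5 : sy.card ≤ bif (P.map c).all (fun s => !(codeBtw (c p) s (2 * N - c p)) &&
          !(codeBtw (c p) (2 * N - s) (2 * N - c p))) then 1 else 0 := by
        by_cases hf : FreePair w (signedPositions (p :: P)) p (-p)
        · have : (P.map c).all (fun s => !(codeBtw (c p) s (2 * N - c p)) &&
              !(codeBtw (c p) (2 * N - s) (2 * N - c p))) = true := by
            simp only [List.all_eq_true, List.mem_map, forall_exists_index, and_imp,
              forall_apply_eq_imp_iff₂, Bool.and_eq_true, Bool.not_eq_true']
            intro k hk
            have hkS : k ∈ signedPositions P := mem_signedPositions.2 (Or.inl hk)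
            have hnkS : -k ∈ signedPositions P := hS'.neg_mem k hkS
            have hnp := hS.neg_mem p hpS
            rw [← hcneg, ← hPneg k hk, ← Bool.not_eq_true, ← Bool.not_eq_true,
              hc.codeBtw_iff (hins p hpS) (hins _ hnp) (hins k (hsub hkS)),
              hc.codeBtw_iff (hins p hpS) (hins _ hnp) (hins _ (hsub hnkS))]
            have l1 := hlt k hkS
            have l2 := hlt _ hnkS
            exact ⟨fun hb => hf.2.1 k (hsub hkS) ⟨Or.inr l1, hb⟩,
              fun hb => hf.2.1 _ (hsub hnkS) ⟨Or.inr l2, hb⟩⟩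
          rw [this, cond_true, hsy, if_pos hf, Finset.card_singleton]
        · rw [hsy, if_neg hf, Finset.card_empty]
          exact Nat.zero_le _
      have hmap : (P ++ 0 :: P.reverse.map Neg.neg).map c
          = P.map c ++ N :: (P.map c).reverse.map (fun s => 2 * N - s) := by
        rw [List.map_append, List.map_cons, hc.map_zero, ← List.map_reverse, List.map_map,
          List.map_map]
        congr 2
        refine List.map_congr_left fun i hi => ?_
        exact hPneg i (List.mem_reverse.1 hi)
      rw [hmap, List.map_nil] at k4
      rw [List.map_cons, codeTotal, codeNew]
      omega
    · simp only [codeFresh, Bool.and_eq_true, Bool.not_eq_true', List.all_eq_true, List.mem_map,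
        forall_exists_index, and_imp, forall_apply_eq_imp_iff₂]
      simp only [← Bool.not_eq_true, Nat.beq_eq]
      refine ⟨fun e => ?_, fun k hk => ⟨fun e => ?_, fun e => ?_⟩⟩
      · exact hS.ne_zero hpS ((hc.eq_iff hS (hins p hpS) h0ins).1 (e.trans hc.map_zero.symm))
      · have := hP.1 k hk
        have := (hc.eq_iff hS (hinsP k hk) (hins p hpS)).1 e
        omega
      · rw [← hcneg] at e
        have := (hc.eq_iff hS (hinsP k hk) (hins _ (hS.neg_mem p hpS))).1 e
        have := hpos k (by simp [hk])
        omega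

theorem SignedConfig.card_filter_pos {w : ℤ → ℤ} {S : Finset ℤ} (h : SignedConfig w S) :
    S.card = 2 * (S.filter (0 < ·)).card := by
  have hneg : (S.filter (0 < ·)).card = (S.filter fun i => ¬ 0 < i).card := by
    refine Finset.card_bij' (fun k _ => -k) (fun k _ => -k) ?_ ?_ (by simp) (by simp)
    · intro k hk
      rw [Finset.mem_filter] at hk ⊢
      exact ⟨h.neg_mem k hk.1, by omega⟩
    · intro k hk
      rw [Finset.mem_filter] at hk ⊢
      have := h.ne_zero hk.1
      exact ⟨h.neg_mem k hk.1, by omega⟩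
  have := Finset.card_filter_add_card_filter_not (s := S) (fun i => 0 < i)
  omega

/-- The code is the rank of the value among those over `S` and the origin. Oddness makes ranks of
opposite positions add up to `2n`. -/
theorem SignedConfig.exists_code {w : ℤ → ℤ} {S : Finset ℤ} (h : SignedConfig w S) {n : ℕ}
    (hn : S.card = 2 * n) : ∃ c, ValueCode w S n c := by
  classical
  set T := insert (0 : ℤ) S with hT
  have hTc : T.card = 2 * n + 1 := by rw [hT, Finset.card_insert_of_notMem h.zero_notMem, hn]
  have hTneg : ∀ i ∈ T, -i ∈ T := by
    intro i hi
    rcases Finset.mem_insert.1 hi with rfl | hi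
    · simp [hT]
    · exact Finset.mem_insert_of_mem (h.neg_mem i hi)
  have mono : ∀ i ∈ T, ∀ j ∈ T, w i < w j →
      (T.filter fun k => w k < w i).card < (T.filter fun k => w k < w j).card := by
    intro i hi j hj hij
    refine Finset.card_lt_card ?_
    rw [Finset.ssubset_iff_of_subset
      (Finset.monotone_filter_right _ (fun k _ hk => lt_trans hk hij))]
    exact ⟨i, by simp [hi, hij], by simp⟩
  have hneg : ∀ i ∈ T, (T.filter fun k => w k < w (-i)).card
      + (T.filter fun k => w k < w i).card = 2 * n := by
    intro i hi
    have e1 : (T.filter fun k => w k < w (-i)).card = (T.filter fun k => w i < w k).card := by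
      refine Finset.card_bij' (fun k _ => -k) (fun k _ => -k) ?_ ?_ ?_ ?_
      · intro k hk
        simp only [Finset.mem_filter, h.odd] at hk ⊢
        exact ⟨hTneg k hk.1, by omega⟩
      · intro k hk
        simp only [Finset.mem_filter, h.odd] at hk ⊢
        exact ⟨hTneg k hk.1, by omega⟩
      · simp
      · simp
    have e2 := Finset.card_filter_add_card_filter_not (s := T) (fun k => w k < w i)
    have e3 : (T.filter fun k => ¬ w k < w i) = insert i (T.filter fun k => w i < w k) := by
      ext k
      simp only [Finset.mem_filter, Finset.mem_insert]
      constructor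
      · rintro ⟨hk, hki⟩
        by_cases e : k = i
        · exact Or.inl e
        · have := h.map_ne e
          exact Or.inr ⟨hk, by omega⟩
      · rintro (rfl | ⟨hk, hki⟩)
        · exact ⟨hi, lt_irrefl _⟩
        · exact ⟨hk, by omega⟩
    rw [e3, Finset.card_insert_of_notMem (by simp)] at e2
    omega
  refine ⟨fun i => (T.filter fun k => w k < w i).card, ?_, ?_, ?_, ?_⟩
  · intro i hi j hj
    refine ⟨fun hlt => ?_, mono i hi j hj⟩
    by_contra hnot
    rcases lt_or_eq_of_le (not_lt.1 hnot) with h1 | h1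
    · exact absurd (mono j hj i hi h1) (by omega)
    · simp only [h1] at hlt
      omega
  · intro i hi
    have := hneg i hi
    omega
  · have := hneg 0 (Finset.mem_insert_self _ _)
    simp only [neg_zero] at this
    omega
  · intro i hi
    have := hneg i hi
    omega

theorem SignedConfig.card_freeEdges_le_of_codeCheck {w : ℤ → ℤ} {S : Finset ℤ}
    (h : SignedConfig w S) {n B : ℕ} (hn : S.card = 2 * n)
    (hcheck : codeCheck n B n [] 0 = true) : (freeEdges w S).card ≤ B := by
  obtain ⟨c, hc⟩ := h.exists_code hn
  set P := (S.filter (0 < ·)).sort (· ≥ ·) with hP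
  have hmemP : ∀ i, i ∈ P ↔ i ∈ S ∧ 0 < i := by
    intro i
    rw [hP, Finset.mem_sort, Finset.mem_filter]
  have hSP : signedPositions P = S := by
    ext i
    rw [mem_signedPositions, hmemP, hmemP, h.neg_mem_iff]
    constructor
    · rintro (h | h)
      · exact h.1
      · exact h.1
    · intro hi
      have := h.ne_zero hi
      rcases lt_or_gt_of_ne this with h | h
      · exact Or.inr ⟨hi, by omega⟩
      · exact Or.inl ⟨hi, h⟩
  have hsorted : P.Pairwise (· > ·) := Finset.sortedGT_sort _ |>.pairwise
  have hpos : ∀ i ∈ P, 0 < i := fun i hi => ((hmemP i).1 hi).2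
  have hlen : P.length = n := by
    rw [hP, Finset.length_sort]
    have := h.card_filter_pos
    omega
  obtain ⟨h1, h2⟩ := card_freeEdges_le_codeTotal n c P (by rwa [hSP]) (by rwa [hSP]) hsorted hpos
  rw [hSP] at h1
  refine h1.trans ?_
  have := codeTotal_le_of_codeCheck (B := B) n [] (P.map c) (by simpa using hlen)
    (by simpa using h2) hcheck
  simpa using this

/-! ### The upper bound for the number of free edges. -/

namespace SignedConfig

variable {w : ℤ → ℤ} {S : Finset ℤ}

/-- Every free edge has at most two ends up to sign, and the edge at the least positive position
has one. -/
theorem sum_card_edgesAt_lt (h : SignedConfig w S) (hS : S.Nonempty) :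
    ∑ p ∈ S.filter (0 < ·), (edgesAt w S p).card < 2 * (freeEdges w S).card := by
  classical
  have hsum := Finset.sum_card_bipartiteAbove_eq_sum_card_bipartiteBelow
    (s := S.filter (0 < ·)) (t := freeEdges w S)
    (fun (p : ℤ) (e : ℤ × ℤ) => e.1 = p ∨ e.1 = -p ∨ e.2 = p ∨ e.2 = -p)
  simp only [Finset.bipartiteAbove, Finset.bipartiteBelow] at hsum
  simp only [edgesAt]
  rw [hsum, mul_comm, ← smul_eq_mul, ← Finset.sum_const]
  have hne : (S.filter (0 < ·)).Nonempty := by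
    obtain ⟨i, hi⟩ := hS
    have := h.ne_zero hi
    rcases lt_or_gt_of_ne this with h0 | h0
    · exact ⟨-i, Finset.mem_filter.2 ⟨h.neg_mem i hi, by omega⟩⟩
    · exact ⟨i, Finset.mem_filter.2 ⟨hi, h0⟩⟩
  obtain ⟨m, hm, hmin⟩ := Finset.exists_min_image _ id hne
  simp only [Finset.mem_filter, id, and_imp] at hm hmin
  refine Finset.sum_lt_sum ?_ ⟨(-m, m), ?_, ?_⟩
  · rintro ⟨i, j⟩ he
    have hsub : ((S.filter (0 < ·)).filter fun p => i = p ∨ i = -p ∨ j = p ∨ j = -p)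
        ⊆ {|i|, |j|} := by
      intro p hp
      simp only [Finset.mem_filter] at hp
      simp only [Finset.mem_insert, Finset.mem_singleton]
      have a1 := abs_of_pos hp.1.2
      rcases hp.2 with rfl | rfl | rfl | rfl
      · exact Or.inl a1.symm
      · exact Or.inl (by rw [abs_neg, a1])
      · exact Or.inr a1.symm
      · exact Or.inr (by rw [abs_neg, a1])
    exact (Finset.card_le_card hsub).trans Finset.card_le_two
  · refine mem_freeEdges.2 ⟨⟨h.neg_mem m hm.1, hm.1⟩, le_refl _, by simp only; omega, by
      simp only; omega, ?_, Or.inl (by simp)⟩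
    intro k hk hb
    simp only [Blocks, StrictBtw] at hb
    have := h.ne_zero hk
    have := hmin k hk
    have := hmin (-k) (h.neg_mem k hk)
    omega
  · have hsub : ((S.filter (0 < ·)).filter fun p => -m = p ∨ -m = -p ∨ m = p ∨ m = -p) ⊆ {m} := by
      intro p hp
      simp only [Finset.mem_filter] at hp
      rw [Finset.mem_singleton]
      omega
    exact (Finset.card_le_card hsub).trans_lt (by simp)

theorem card_freeEdges_le_of_le_five (h : SignedConfig w S) {n : ℕ} (hn : S.card = 2 * n)
    (h2 : 2 ≤ n) (h5 : n ≤ 5) : (freeEdges w S).card ≤ 4 * (n - 1) := by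
  interval_cases n
  · exact h.card_freeEdges_le_of_codeCheck hn codeCheck_two
  · exact h.card_freeEdges_le_of_codeCheck hn codeCheck_three
  · exact h.card_freeEdges_le_of_codeCheck hn codeCheck_four
  · exact h.card_freeEdges_le_of_codeCheck hn codeCheck_five

/-- Let `E` be the number of edges and delete the pair `±p` with fewest incident edges. Then `E -
16` is at most that minimum, and six times the minimum is less than `2E`, so `6 (E - 16) < 2E` and
`E < 24`. The strictness in `sum_card_edgesAt_lt` is essential. -/
theorem card_freeEdges_le_of_card_eq_twelve (h : SignedConfig w S) (hn : S.card = 12) :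
    (freeEdges w S).card ≤ 23 := by
  have hc := h.card_filter_pos
  have hlt := h.sum_card_edgesAt_lt (Finset.card_pos.1 (by omega))
  have hne : (S.filter (0 < ·)).Nonempty := Finset.card_pos.1 (by omega)
  obtain ⟨p, hp, hmin⟩ := Finset.exists_min_image _ (fun p => (edgesAt w S p).card) hne
  have hsum := Finset.card_nsmul_le_sum _ _ _ hmin
  rw [smul_eq_mul] at hsum
  have hpS := (Finset.mem_filter.1 hp).1
  have h1 := card_freeEdges_le_erase_pair_add_edgesAt w S p
  have h2 := h.card_erase_pair hpS
  have h3 := (h.erase_pair p).card_freeEdges_le_of_le_five (n := 5) (by omega) (by omega)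
    (by omega)
  have h4 : (S.filter (0 < ·)).card = 6 := by omega
  rw [h4] at hsum
  omega

/-- Deleting one pair loses at most `n` edges, deleting two loses at most `2n`, and the claimed
bound drops by at least as much. Starting the induction step at 7 keeps `n - 2 ≥ 5`. -/
theorem card_freeEdges_le_of_five_le (n : ℕ) : ∀ {S : Finset ℤ}, SignedConfig w S →
    S.card = 2 * n → 5 ≤ n → (freeEdges w S).card ≤ n ^ 2 / 2 + n - 1 := by
  induction n using Nat.strong_induction_on with
  | _ n ih =>
    intro S h hn h5
    rcases (by omega : n = 5 ∨ n = 6 ∨ 7 ≤ n) with rfl | rfl | h7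
    · exact h.card_freeEdges_le_of_le_five hn (by omega) (by omega)
    · exact h.card_freeEdges_le_of_card_eq_twelve hn
    · obtain ⟨m, rfl⟩ : ∃ m, n = m + 2 := ⟨n - 2, by omega⟩
      have e1 : (m + 2) ^ 2 = m ^ 2 + 4 * m + 4 := by ring
      have e2 : (m + 1) ^ 2 = m ^ 2 + 2 * m + 1 := by ring
      rcases h.exists_few_edges (by omega) with ⟨p, hp, hle⟩ | ⟨p, hp, q, hq, h1, h2, hle⟩
      · have k1 := h.card_freeEdges_le_erase_pair p
        have k2 := h.card_erase_pair hp
        have k3 := ih (m + 1) (by omega) (h.erase_pair p) (by omega) (by omega)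
        omega
      · have k1 := h.card_freeEdges_le_erase_two_pairs hp hq h1 h2
        have k2 := h.card_erase_pair hp
        have hq' : q ∈ S \ {p, -p} := by
          simp only [Finset.mem_sdiff, Finset.mem_insert, Finset.mem_singleton]
          exact ⟨hq, by omega⟩
        have k3 := (h.erase_pair p).card_erase_pair hq'
        have k4 := ih m (by omega) ((h.erase_pair p).erase_pair q) (by omega) (by omega)
        omega

end SignedConfig

/-! ### Twice the length, as a statistic on functions -/

/-- For a signed permutation `w` of `S`, this is twice the Coxeter length: the number of inversions
plus the number of positive positions with a negative value. -/
def doubleLength (w : ℤ → ℤ) (S : Finset ℤ) : ℕ :=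
  (∑ x ∈ S, ∑ y ∈ S, if x < y ∧ w y < w x then 1 else 0)
    + ∑ x ∈ S, if 0 < x ∧ w x < 0 then 1 else 0

theorem sum_eq_add_add_sum_sdiff {S : Finset ℤ} {i j : ℤ} (hi : i ∈ S) (hj : j ∈ S) (hij : i ≠ j)
    (g : ℤ → ℕ) : ∑ x ∈ S, g x = g i + g j + ∑ x ∈ S \ {i, j}, g x := by
  have hsub : {i, j} ⊆ S := by
    intro x hx
    rcases Finset.mem_insert.1 hx with rfl | hx
    · exact hi
    · rwa [Finset.mem_singleton.1 hx]
  rw [← Finset.sum_sdiff hsub, Finset.sum_pair hij, add_comm]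

/-- Interchanging a rise creates one inversion, and two more for each point in the rectangle; other
points contribute the same as before. Only injectivity is assumed, since the first half of a
nonsymmetric signed interchange destroys oddness. -/
theorem doubleLength_comp_swap {w : ℤ → ℤ} {S : Finset ℤ} {i j : ℤ} (hw : Function.Injective w)
    (hi : i ∈ S) (hj : j ∈ S) (hij : i < j) (hwij : w i < w j) :
    doubleLength (w ∘ Equiv.swap i j) S
        + ((if 0 < i ∧ w i < 0 then 1 else 0) + (if 0 < j ∧ w j < 0 then 1 else 0))
      = doubleLength w S + 1 + 2 * (S.filter fun k => Blocks w i j k).card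
        + ((if 0 < i ∧ w j < 0 then 1 else 0) + (if 0 < j ∧ w i < 0 then 1 else 0)) := by
  classical
  set T := S \ {i, j} with hT
  set w' := w ∘ Equiv.swap i j with hw'
  have wi : w' i = w j := by simp [hw']
  have wj : w' j = w i := by simp [hw']
  have wk : ∀ k ∈ T, w' k = w k := by
    intro k hk
    simp only [hT, Finset.mem_sdiff, Finset.mem_insert, Finset.mem_singleton, not_or] at hk
    simp [hw', Equiv.swap_apply_of_ne_of_ne hk.2.1 hk.2.2]
  -- Inversions are split by whether they involve both, one or neither of the positions `i, j`.
  have dec : ∀ v : ℤ → ℤ, (∑ x ∈ S, ∑ y ∈ S, if x < y ∧ v y < v x then 1 else 0)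
      = (if v j < v i then 1 else 0) + (∑ k ∈ T,
        ((if i < k ∧ v k < v i then 1 else 0) + (if j < k ∧ v k < v j then 1 else 0)
          + ((if k < i ∧ v i < v k then 1 else 0) + (if k < j ∧ v j < v k then 1 else 0))))
        + ∑ x ∈ T, ∑ y ∈ T, if x < y ∧ v y < v x then 1 else 0 := by
    intro v
    rw [sum_eq_add_add_sum_sdiff hi hj hij.ne]
    simp only [sum_eq_add_add_sum_sdiff hi hj hij.ne (fun y => if _ < y ∧ v y < _ then 1 else 0)]
    simp only [Finset.sum_add_distrib, lt_irrefl, false_and, if_false, hij, true_and, hij.not_gt]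
    ring
  have hcard : (S.filter fun k => Blocks w i j k).card
      = ∑ k ∈ T, if Blocks w i j k then 1 else 0 := by
    rw [Finset.card_filter, sum_eq_add_add_sum_sdiff hi hj hij.ne]
    simp [Blocks, StrictBtw, hT]
  have hmid : (∑ k ∈ T,
        ((if i < k ∧ w' k < w' i then 1 else 0) + (if j < k ∧ w' k < w' j then 1 else 0)
          + ((if k < i ∧ w' i < w' k then 1 else 0) + (if k < j ∧ w' j < w' k then 1 else 0))))
      = (∑ k ∈ T,
        ((if i < k ∧ w k < w i then 1 else 0) + (if j < k ∧ w k < w j then 1 else 0)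
          + ((if k < i ∧ w i < w k then 1 else 0) + (if k < j ∧ w j < w k then 1 else 0))))
        + 2 * ∑ k ∈ T, if Blocks w i j k then 1 else 0 := by
    rw [Finset.mul_sum, ← Finset.sum_add_distrib]
    refine Finset.sum_congr rfl fun k hk => ?_
    rw [wi, wj, wk k hk]
    simp only [hT, Finset.mem_sdiff, Finset.mem_insert, Finset.mem_singleton, not_or] at hk
    have n1 : w k ≠ w i := fun e => hk.2.1 (hw e)
    have n2 : w k ≠ w j := fun e => hk.2.2 (hw e)
    obtain ⟨-, m1, m2⟩ := hk
    rcases (by omega : k < i ∨ (i < k ∧ k < j) ∨ j < k) with c | c | c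
    · have : ¬ Blocks w i j k := by simp only [Blocks, StrictBtw]; omega
      simp only [this, if_false, c, show ¬ i < k by omega, show ¬ j < k by omega,
        show k < j by omega, true_and, false_and]
      omega
    · simp only [c, show ¬ j < k by omega, show ¬ k < i by omega, true_and, false_and, if_false,
        Blocks, StrictBtw, and_self, true_or]
      split_ifs <;> omega
    · have : ¬ Blocks w i j k := by simp only [Blocks, StrictBtw]; omega
      simp only [this, if_false, c, show i < k by omega, show ¬ k < i by omega,
        show ¬ k < j by omega, true_and, false_and]
      omega
  have hrest : (∑ x ∈ T, ∑ y ∈ T, if x < y ∧ w' y < w' x then 1 else 0)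
      = ∑ x ∈ T, ∑ y ∈ T, if x < y ∧ w y < w x then 1 else 0 := by
    refine Finset.sum_congr rfl fun x hx => Finset.sum_congr rfl fun y hy => ?_
    rw [wk x hx, wk y hy]
  have hneg : (∑ x ∈ T, if 0 < x ∧ w' x < 0 then 1 else 0)
      = ∑ x ∈ T, if 0 < x ∧ w x < 0 then 1 else 0 :=
    Finset.sum_congr rfl fun x hx => by rw [wk x hx]
  rw [doubleLength, doubleLength, dec w', dec w, hmid, hrest, hcard,
    sum_eq_add_add_sum_sdiff hi hj hij.ne, hneg,
    sum_eq_add_add_sum_sdiff hi hj hij.ne (fun x => if 0 < x ∧ w x < 0 then 1 else 0),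
    wi, wj, if_pos hwij, if_neg hwij.not_gt]
  ring

/-- The map that interchanges `a` with `b` and `-a` with `-b`. -/
def signedSwapInt (a b x : ℤ) : ℤ :=
  if x = a then b else if x = b then a else if x = -a then -b else if x = -b then -a else x

theorem signedSwapInt_eq_swap {a : ℤ} : signedSwapInt a (-a) = Equiv.swap a (-a) := by
  funext x
  rw [signedSwapInt, Equiv.swap_apply_def]
  split_ifs <;> omega

theorem signedSwapInt_eq_swap_comp {a b : ℤ} (ha : a ≠ 0) (hb : b ≠ 0) (hab : a ≠ b)
    (hab' : b ≠ -a) :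
    signedSwapInt a b = Equiv.swap a b ∘ Equiv.swap (-b) (-a) := by
  funext x
  simp only [signedSwapInt, Function.comp_apply, Equiv.swap_apply_def]
  split_ifs <;> omega

/-- A symmetric interchange gains one inversion and one negative value at a positive position; a
nonsymmetric one is two successive ordinary interchanges, each gaining at least one inversion.
Freeness removes the further contributions of blocking points. -/
theorem SignedConfig.doubleLength_rise {w : ℤ → ℤ} {S : Finset ℤ} (h : SignedConfig w S) {i j : ℤ}
    (hi : i ∈ S) (hj : j ∈ S) (hij : i < j) (hwij : w i < w j) :
    doubleLength w S + 2 ≤ doubleLength (w ∘ signedSwapInt i j) S ∧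
    (FreePair w S i j → doubleLength (w ∘ signedSwapInt i j) S = doubleLength w S + 2) := by
  classical
  have hi0 := h.ne_zero hi
  have hj0 := h.ne_zero hj
  have k1 := doubleLength_comp_swap h.inj hi hj hij hwij
  have nofilter : FreePair w S i j → (S.filter fun k => Blocks w i j k).card = 0 := by
    intro hf
    rw [Finset.card_eq_zero, Finset.filter_eq_empty_iff]
    exact fun k hk => hf.2.1 k hk
  by_cases hs : j = -i
  · subst hs
    have hi1 : i < 0 := by omega
    have oi := h.odd i
    rw [signedSwapInt_eq_swap]
    simp only [show ¬ 0 < i by omega, show 0 < -i by omega, show ¬ w (-i) < 0 by omega,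
      show w i < 0 by omega, true_and, false_and, if_true, if_false] at k1
    refine ⟨by omega, fun hf => ?_⟩
    have := nofilter hf
    omega
  · have hni := h.neg_mem i hi
    have hnj := h.neg_mem j hj
    have oi := h.odd i
    have oj := h.odd j
    set w1 := w ∘ Equiv.swap i j with hw1
    have e1 : w1 (-i) = - w i := by
      rw [hw1, Function.comp_apply, Equiv.swap_apply_of_ne_of_ne (by omega) (by omega), oi]
    have e2 : w1 (-j) = - w j := by
      rw [hw1, Function.comp_apply, Equiv.swap_apply_of_ne_of_ne (by omega) (by omega), oj]
    have k2 := doubleLength_comp_swap (w := w1) (h.inj.comp (Equiv.injective _)) hnj hni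
      (by omega) (by omega)
    rw [signedSwapInt_eq_swap_comp hi0 hj0 hij.ne hs, ← Function.comp_assoc, ← hw1]
    rw [e1, e2] at k2
    refine ⟨by split_ifs at k1 k2 <;> omega, fun hf => ?_⟩
    have hc := h.not_central hf hs
    have m1 := nofilter hf
    -- After the first interchange the moved points `i, j` could block `-j, -i` only if the origin
    -- blocked the original pair; any other blocker reflects to a blocker of `i, j`.
    have m2 : (S.filter fun k => Blocks w1 (-j) (-i) k).card = 0 := by
      rw [Finset.card_eq_zero, Finset.filter_eq_empty_iff]
      intro k hk hb
      simp only [Blocks, StrictBtw, e1, e2] at hb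
      have ok := h.odd k
      by_cases c1 : k = i
      · subst c1
        have : w1 k = w j := by simp [hw1]
        omega
      · by_cases c2 : k = j
        · subst c2
          have : w1 k = w i := by simp [hw1]
          omega
        · have : w1 k = w k := by
            rw [hw1, Function.comp_apply, Equiv.swap_apply_of_ne_of_ne c1 c2]
          have b := hf.not_blocks (h.neg_mem k hk)
          omega
    rw [m1] at k1
    rw [m2] at k2
    have := h.map_ne_zero hi
    have := h.map_ne_zero hj
    split_ifs at k1 k2 <;> omega

/-- Interchanging the values of a pair of positions does not affect whether it is free. -/
theorem SignedConfig.freePair_comp_signedSwapInt {w : ℤ → ℤ} {S : Finset ℤ}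
    (h : SignedConfig w S) {i j : ℤ} (hi : i ∈ S) (hj : j ∈ S) (hf : FreePair w S i j) :
    FreePair (w ∘ signedSwapInt i j) S i j := by
  have hi0 := h.ne_zero hi
  have hj0 := h.ne_zero hj
  have e1 : (w ∘ signedSwapInt i j) i = w j := by simp [signedSwapInt]
  have e2 : (w ∘ signedSwapInt i j) j = w i := by
    simp only [Function.comp_apply, signedSwapInt]
    congr 1
    split_ifs <;> omega
  have oi := h.odd i
  have oj := h.odd j
  refine ⟨hf.1, fun k hk hb => ?_, ?_⟩
  · simp only [Blocks, StrictBtw, e1, e2] at hb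
    have e3 : (w ∘ signedSwapInt i j) k = w (signedSwapInt i j k) := rfl
    rw [e3, signedSwapInt] at hb
    have b := hf.not_blocks hk
    by_cases hs : j = -i
    · split_ifs at hb <;> omega
    · have hc := h.not_central hf hs
      split_ifs at hb <;> omega
  · refine hf.2.2.imp id fun hn hb => hn ?_
    have e0 : (w ∘ signedSwapInt i j) 0 = w 0 := by
      simp only [Function.comp_apply, signedSwapInt]
      congr 1
      split_ifs <;> omega
    simp only [Blocks, StrictBtw, e1, e2, e0] at hb ⊢
    omega

/-! ### Signed permutations as functions on the integers -/

/-- The set `{-n, …, n} \ {0}` as a finite set of integers. -/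
noncomputable abbrev positions (n : ℕ) : Finset ℤ := (Finset.Icc (-(n : ℤ)) (n : ℤ)).erase 0

theorem mem_positions {n : ℕ} {x : ℤ} : x ∈ positions n ↔ x ≠ 0 ∧ -(n : ℤ) ≤ x ∧ x ≤ n := by
  rw [Finset.mem_erase, Finset.mem_Icc]

theorem card_positions (n : ℕ) : (positions n).card = 2 * n := by
  rw [Finset.card_erase_of_mem (by simp), Int.card_Icc]
  omega

namespace SignedPerm

variable {n : ℕ}

/-- A signed permutation, extended by the identity to all integers. -/
noncomputable def extend (g : SignedPerm n) (x : ℤ) : ℤ :=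
  if hx : x ∈ positions n then (g.1 ⟨x, hx⟩).1 else x

theorem extend_of_mem (g : SignedPerm n) {x : ℤ} (hx : x ∈ positions n) :
    extend g x = (g.1 ⟨x, hx⟩).1 := dif_pos hx

theorem extend_of_notMem (g : SignedPerm n) {x : ℤ} (hx : x ∉ positions n) :
    extend g x = x := dif_neg hx

theorem extend_coe (g : SignedPerm n) (x : SignedIdx n) : extend g x.1 = (g.1 x).1 :=
  extend_of_mem g x.2

theorem extend_mem (g : SignedPerm n) {x : ℤ} (hx : x ∈ positions n) :
    extend g x ∈ positions n := by
  rw [extend_of_mem g hx]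
  exact (g.1 ⟨x, hx⟩).2

theorem extend_mul (g h : SignedPerm n) : extend (g * h) = extend g ∘ extend h := by
  funext x
  by_cases hx : x ∈ positions n
  · rw [Function.comp_apply, extend_of_mem h hx, extend_coe, extend_of_mem _ hx]
    rfl
  · rw [Function.comp_apply, extend_of_notMem _ hx, extend_of_notMem h hx, extend_of_notMem g hx]

theorem extend_one : extend (1 : SignedPerm n) = id := by
  funext x
  by_cases hx : x ∈ positions n
  · rw [extend_of_mem _ hx]
    rfl
  · exact extend_of_notMem _ hx

theorem extend_injective : Function.Injective (extend (n := n)) := by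
  intro g h e
  refine Subtype.ext (Equiv.ext fun x => Subtype.ext ?_)
  rw [← extend_coe, ← extend_coe, e]

theorem signedConfig (g : SignedPerm n) : SignedConfig (extend g) (positions n) where
  odd := by
    intro x
    by_cases hx : x ∈ positions n
    · have hg := g.2 ⟨x, hx⟩
      have := congrArg Subtype.val hg
      rw [← extend_coe] at this
      rw [extend_of_mem g hx]
      exact this
    · have hx' : -x ∉ positions n := by
        rw [mem_positions] at hx ⊢
        omega
      rw [extend_of_notMem g hx, extend_of_notMem g hx']
  inj := by
    have h : Function.LeftInverse (extend g⁻¹) (extend g) := fun x => by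
      rw [← Function.comp_apply (f := extend g⁻¹), ← extend_mul, inv_mul_cancel, extend_one, id]
    exact h.injective
  neg_mem := by
    intro x hx
    rw [mem_positions] at hx ⊢
    omega
  zero_notMem := by simp

theorem extend_signedSwap {a b : SignedIdx n} (hab : a ≠ b) :
    extend (signedSwap a b) = signedSwapInt a.1 b.1 := by
  have ha := mem_positions.1 a.2
  have hb := mem_positions.1 b.2
  have hab' : a.1 ≠ b.1 := fun e => hab (Subtype.ext e)
  funext x
  by_cases hx : x ∈ positions n
  · rw [extend_of_mem _ hx, signedSwap]
    have hx' := mem_positions.1 hx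
    have key : ∀ c d y : SignedIdx n, (Equiv.swap c d y).1 = Equiv.swap c.1 d.1 y.1 := by
      intro c d y
      rw [Equiv.swap_apply_def, Equiv.swap_apply_def]
      simp only [Subtype.ext_iff]
      split_ifs <;> rfl
    have hneg : ∀ c : SignedIdx n, c.neg.1 = -c.1 := fun _ => rfl
    split_ifs with h
    · have h' : b.1 = -a.1 := congrArg Subtype.val h
      rw [key]
      simp only [Equiv.swap_apply_def, signedSwapInt]
      split_ifs <;> omega
    · have h' : b.1 ≠ -a.1 := fun e => h (Subtype.ext e)
      rw [Equiv.Perm.mul_apply, key, key, hneg, hneg]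
      simp only [Equiv.swap_apply_def, signedSwapInt]
      split_ifs <;> omega
  · rw [extend_of_notMem _ hx]
    rw [mem_positions] at hx
    simp only [signedSwapInt]
    split_ifs <;> omega

/-- The reflection of `B_n` that interchanges the positions `i` and `j`. -/
noncomputable def reflection (n : ℕ) (i j : ℤ) : SignedPerm n :=
  if h : i ∈ positions n ∧ j ∈ positions n then signedSwap ⟨i, h.1⟩ ⟨j, h.2⟩ else 1

theorem extend_reflection {i j : ℤ} (hi : i ∈ positions n) (hj : j ∈ positions n) (hij : i ≠ j) :
    extend (reflection n i j) = signedSwapInt i j := by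
  rw [reflection, dif_pos ⟨hi, hj⟩]
  exact extend_signedSwap (fun e => hij (congrArg Subtype.val e))

theorem extend_mul_reflection (g : SignedPerm n) {i j : ℤ} (hi : i ∈ positions n)
    (hj : j ∈ positions n) (hij : i ≠ j) :
    extend (g * reflection n i j) = extend g ∘ signedSwapInt i j := by
  rw [extend_mul, extend_reflection hi hj hij]

theorem signedSwap_coe (a b : SignedIdx n) : signedSwap a b = reflection n a.1 b.1 := by
  rw [reflection, dif_pos ⟨a.2, b.2⟩]

/-- This translates between left multiplication, used in the definition of the order and acting on
values, and right multiplication, acting on positions. -/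
theorem conj_reflection (g : SignedPerm n) {i j : ℤ} (hi : i ∈ positions n)
    (hj : j ∈ positions n) (hij : i ≠ j) :
    g * reflection n i j = reflection n (extend g i) (extend g j) * g := by
  apply extend_injective
  have hc := g.signedConfig
  rw [extend_mul_reflection g hi hj hij, extend_mul, extend_reflection (extend_mem g hi)
    (extend_mem g hj) (hc.map_ne hij)]
  funext x
  have e1 : ∀ y, extend g x = extend g y ↔ x = y := fun y => hc.inj.eq_iff
  simp only [Function.comp_apply, signedSwapInt, ← hc.odd, e1]
  split_ifs <;> rfl

theorem reflection_comm {i j : ℤ} (hi : i ∈ positions n)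
    (hj : j ∈ positions n) (hij : i ≠ j) : reflection n i j = reflection n j i := by
  apply extend_injective
  rw [extend_reflection hi hj hij, extend_reflection hj hi hij.symm]
  have := (mem_positions.1 hi).1
  have := (mem_positions.1 hj).1
  funext x
  simp only [signedSwapInt]
  split_ifs <;> omega

theorem reflection_mul_self {i j : ℤ} (hi : i ∈ positions n)
    (hj : j ∈ positions n) (hij : i ≠ j) : reflection n i j * reflection n i j = 1 := by
  apply extend_injective
  rw [extend_mul_reflection _ hi hj hij, extend_reflection hi hj hij, extend_one]
  have := (mem_positions.1 hi).1
  have := (mem_positions.1 hj).1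
  funext x
  simp only [signedSwapInt, Function.comp_apply, id]
  split_ifs <;> omega

/-- Twice the length of a signed permutation. -/
noncomputable def length₂ (g : SignedPerm n) : ℕ := doubleLength (extend g) (positions n)

theorem length₂_rise (g : SignedPerm n) {i j : ℤ} (hi : i ∈ positions n)
    (hj : j ∈ positions n) (hij : i < j) (hg : extend g i < extend g j) :
    length₂ g + 2 ≤ length₂ (g * reflection n i j) ∧
    (FreePair (extend g) (positions n) i j →
      length₂ (g * reflection n i j) = length₂ g + 2) := by
  rw [length₂, length₂, extend_mul_reflection g hi hj hij.ne]
  exact g.signedConfig.doubleLength_rise hi hj hij hg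

theorem length₂_fall (g : SignedPerm n) {i j : ℤ} (hi : i ∈ positions n)
    (hj : j ∈ positions n) (hij : i < j) (hg : extend g j < extend g i) :
    length₂ (g * reflection n i j) + 2 ≤ length₂ g ∧
    (FreePair (extend g) (positions n) i j →
      length₂ g = length₂ (g * reflection n i j) + 2) := by
  have hi0 := (mem_positions.1 hi).1
  have hj0 := (mem_positions.1 hj).1
  have e : g * reflection n i j * reflection n i j = g := by
    rw [mul_assoc, reflection_mul_self hi hj hij.ne, mul_one]
  -- A fall of `g` is a rise of `g * reflection n i j`, and the reflection is an involution.
  have hr := length₂_rise (g * reflection n i j) hi hj hij (by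
    rw [extend_mul_reflection g hi hj hij.ne]
    have e1 : signedSwapInt i j i = j := by simp [signedSwapInt]
    have e2 : signedSwapInt i j j = i := by
      simp only [signedSwapInt]
      split_ifs <;> omega
    simpa only [Function.comp_apply, e1, e2] using hg)
  rw [e] at hr
  refine ⟨hr.1, fun hf => hr.2 ?_⟩
  rw [extend_mul_reflection g hi hj hij.ne]
  exact g.signedConfig.freePair_comp_signedSwapInt hi hj hf

theorem length₂_one : length₂ (1 : SignedPerm n) = 0 := by
  rw [length₂, extend_one, doubleLength]
  simp only [id]
  have h1 : ∀ x y : ℤ, ¬ (x < y ∧ y < x) := fun x y => by omega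
  simp [h1]

/-- A pair of neighbouring positions is free. -/
theorem freePair_of_generator (g : SignedPerm n) {i j : ℤ}
    (h : (i = -1 ∧ j = 1) ∨ (1 ≤ i ∧ j = i + 1)) : FreePair (extend g) (positions n) i j := by
  refine ⟨by omega, fun k hk hb => ?_, ?_⟩
  · have := (mem_positions.1 hk).1
    simp only [Blocks, StrictBtw] at hb
    omega
  · rcases h with h | h
    · exact Or.inl (by omega)
    · refine Or.inr fun hb => ?_
      simp only [Blocks, StrictBtw] at hb
      omega

theorem mem_coxeterGenerators {s : SignedPerm n} :
    s ∈ coxeterGenerators n ↔ ∃ i ∈ positions n, ∃ j ∈ positions n,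
      ((i = -1 ∧ j = 1) ∨ (1 ≤ i ∧ j = i + 1)) ∧ s = reflection n i j := by
  constructor
  · rintro (⟨a, ha, rfl⟩ | ⟨a, b, ha, hb, rfl⟩)
    · have h1 : (1 : ℤ) ∈ positions n := ha ▸ a.2
      have h2 : (-1 : ℤ) ∈ positions n := by
        rw [mem_positions] at h1 ⊢
        omega
      refine ⟨-1, h2, 1, h1, Or.inl ⟨rfl, rfl⟩, ?_⟩
      have hneg : a.neg.1 = -1 := by rw [← ha]; rfl
      rw [signedSwap_coe, ha, hneg, reflection_comm h1 h2 (by decide)]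
    · exact ⟨a.1, a.2, b.1, b.2, Or.inr ⟨ha, hb⟩, signedSwap_coe a b⟩
  · rintro ⟨i, hi, j, hj, (⟨rfl, rfl⟩ | ⟨h1, h2⟩), rfl⟩
    · refine Or.inl ⟨⟨1, hj⟩, rfl, ?_⟩
      rw [signedSwap_coe, reflection_comm hi hj (by decide)]
      rfl
    · exact Or.inr ⟨⟨i, hi⟩, ⟨j, hj⟩, h1, h2, (signedSwap_coe ⟨i, hi⟩ ⟨j, hj⟩).symm⟩

theorem length₂_mul_generator (g : SignedPerm n) {s : SignedPerm n}
    (hs : s ∈ coxeterGenerators n) : length₂ (g * s) ≤ length₂ g + 2 := by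
  obtain ⟨i, hi, j, hj, hij, rfl⟩ := mem_coxeterGenerators.1 hs
  have hlt : i < j := by omega
  rcases lt_or_gt_of_ne (g.signedConfig.map_ne hlt.ne) with hg | hg
  · exact ((g.length₂_rise hi hj hlt hg).2 (g.freePair_of_generator hij)).le
  · have := (g.length₂_fall hi hj hlt hg).1
    omega

/-- A signed permutation without descents is the identity. -/
theorem eq_one_of_forall_lt (g : SignedPerm n)
    (h : ∀ i ∈ positions n, ∀ j ∈ positions n, ((i = -1 ∧ j = 1) ∨ (1 ≤ i ∧ j = i + 1)) →
      extend g i < extend g j) : g = 1 := by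
  have hc := g.signedConfig
  -- The values at `1, …, n` are positive and increasing, hence at least the positions; the bound
  -- `n` at the top forces equality downwards.
  have pos : ∀ k : ℕ, k + 1 ≤ n → (k : ℤ) + 1 ≤ extend g (k + 1) := by
    intro k
    induction k with
    | zero =>
      intro hk
      have := h (-1) (by rw [mem_positions]; omega) 1 (by rw [mem_positions]; omega)
        (Or.inl ⟨rfl, rfl⟩)
      rw [hc.odd] at this
      simp only [Nat.cast_zero, zero_add]
      omega
    | succ k ih =>
      intro hk
      have h1 := ih (by omega)
      have h2 := h ((k : ℤ) + 1) (by rw [mem_positions]; omega) ((k : ℤ) + 1 + 1)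
        (by rw [mem_positions]; omega) (Or.inr ⟨by omega, rfl⟩)
      push_cast
      omega
  have top : ∀ d k : ℕ, k + 1 + d = n → extend g (k + 1) ≤ (k : ℤ) + 1 := by
    intro d
    induction d with
    | zero =>
      intro k hk
      have hm := mem_positions.1 (extend_mem g (x := (k : ℤ) + 1)
        (by rw [mem_positions]; omega))
      omega
    | succ d ih =>
      intro k hk
      have h1 := ih (k + 1) (by omega)
      have h2 := h ((k : ℤ) + 1) (by rw [mem_positions]; omega) ((k : ℤ) + 1 + 1)
        (by rw [mem_positions]; omega) (Or.inr ⟨by omega, rfl⟩)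
      push_cast at h1
      omega
  have fix : ∀ k : ℕ, k + 1 ≤ n → extend g (k + 1) = (k : ℤ) + 1 := fun k hk =>
    le_antisymm (top (n - (k + 1)) k (by omega)) (pos k hk)
  apply extend_injective
  rw [extend_one]
  funext x
  by_cases hx : x ∈ positions n
  · rw [mem_positions] at hx
    rcases lt_or_gt_of_ne hx.1 with h0 | h0
    · have := fix (x.natAbs - 1) (by omega)
      have e : ((x.natAbs - 1 : ℕ) : ℤ) + 1 = -x := by omega
      rw [e, hc.odd] at this
      rw [id]
      omega
    · have := fix (x.natAbs - 1) (by omega)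
      have e : ((x.natAbs - 1 : ℕ) : ℤ) + 1 = x := by omega
      rwa [e] at this
  · exact extend_of_notMem g hx

theorem exists_word (k : ℕ) : ∀ g : SignedPerm n, length₂ g ≤ 2 * k →
    ∃ l : List (SignedPerm n), (∀ s ∈ l, s ∈ coxeterGenerators n) ∧ l.prod = g ∧
      2 * l.length = length₂ g := by
  have hdesc : ∀ g : SignedPerm n, g ≠ 1 → ∃ s ∈ coxeterGenerators n,
      g * s * s = g ∧ length₂ g = length₂ (g * s) + 2 := by
    intro g hg
    by_contra hcon
    refine hg (g.eq_one_of_forall_lt fun i hi j hj hij => ?_)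
    by_contra hge
    have hlt : i < j := by omega
    have hne := g.signedConfig.map_ne hlt.ne
    refine hcon ⟨reflection n i j, mem_coxeterGenerators.2 ⟨i, hi, j, hj, hij, rfl⟩, ?_,
      (g.length₂_fall hi hj hlt (by omega)).2 (g.freePair_of_generator hij)⟩
    rw [mul_assoc, reflection_mul_self hi hj hlt.ne, mul_one]
  induction k with
  | zero =>
    intro g hg
    by_cases h1 : g = 1
    · exact ⟨[], by simp, by simp [h1], by simp [h1, length₂_one]⟩
    · obtain ⟨s, -, -, hs⟩ := hdesc g h1
      omega
  | succ k ih =>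
    intro g hg
    by_cases h1 : g = 1
    · exact ⟨[], by simp, by simp [h1], by simp [h1, length₂_one]⟩
    · obtain ⟨s, hs, hss, hl⟩ := hdesc g h1
      obtain ⟨l, h2, h3, h4⟩ := ih (g * s) (by omega)
      refine ⟨l ++ [s], ?_, ?_, ?_⟩
      · intro t ht
        rcases List.mem_append.1 ht with ht | ht
        · exact h2 t ht
        · rwa [List.mem_singleton.1 ht]
      · rw [List.prod_append, h3, List.prod_singleton, hss]
      · rw [List.length_append, List.length_singleton]
        omega

theorem length₂_prod_le (l : List (SignedPerm n)) (hl : ∀ s ∈ l, s ∈ coxeterGenerators n) :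
    length₂ l.prod ≤ 2 * l.length := by
  induction l using List.reverseRecOn with
  | nil => simp [length₂_one]
  | append_singleton l s ih =>
    have h1 := ih fun t ht => hl t (by simp [ht])
    have h2 := length₂_mul_generator l.prod (hl s (by simp))
    rw [List.prod_append, List.prod_singleton, List.length_append, List.length_singleton]
    omega

/-- A generator raises the statistic by at most 2, and every nonidentity element has a generator
that lowers it by exactly 2. -/
theorem two_mul_wordLength (g : SignedPerm n) :
    2 * wordLength (coxeterGenerators n) g = length₂ g := by
  obtain ⟨l, h1, h2, h3⟩ := exists_word (length₂ g) g (by omega)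
  have hle : wordLength (coxeterGenerators n) g ≤ l.length := Nat.sInf_le ⟨l, h1, h2, rfl⟩
  obtain ⟨l', h1', h2', h3'⟩ := Nat.sInf_mem
    (s := {k : ℕ | ∃ l : List (SignedPerm n), (∀ s ∈ l, s ∈ coxeterGenerators n) ∧ l.prod = g ∧
      l.length = k}) ⟨_, l, h1, h2, rfl⟩
  have hge := length₂_prod_le l' h1'
  rw [h2', h3'] at hge
  change length₂ g ≤ 2 * wordLength (coxeterGenerators n) g at hge
  omega

end SignedPerm

/-! ### Coverings in Bruhat order as free pairs. -/

namespace SignedPerm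

variable {n : ℕ}

/-- Conjugate the interchange of `-1, 1` by an element taking `1` to `i`, or that of `1, 2` by an
element taking `1, 2` to `i, j`. -/
theorem isBruhatReflection_reflection {i j : ℤ} (hi : i ∈ positions n) (hj : j ∈ positions n)
    (hij : i ≠ j) : IsBruhatReflection (coxeterGenerators n) (reflection n i j) := by
  have hi' := mem_positions.1 hi
  have hj' := mem_positions.1 hj
  have h1 : (1 : ℤ) ∈ positions n := by rw [mem_positions]; omega
  have h1' : (-1 : ℤ) ∈ positions n := by rw [mem_positions]; omega
  -- a signed permutation that takes `1` to `i`
  obtain ⟨g, hg⟩ : ∃ g : SignedPerm n, extend g 1 = i := by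
    by_cases h : i = 1
    · exact ⟨1, by rw [extend_one, h, id]⟩
    · refine ⟨reflection n 1 i, ?_⟩
      rw [extend_reflection h1 hi (fun e => h e.symm)]
      simp [signedSwapInt]
  have hc := g.signedConfig
  by_cases hs : j = -i
  · refine ⟨reflection n (-1) 1, mem_coxeterGenerators.2 ⟨-1, h1', 1, h1, Or.inl ⟨rfl, rfl⟩, rfl⟩,
      g, ?_⟩
    rw [conj_reflection g h1' h1 (by decide), hc.odd, hg, mul_inv_cancel_right, hs]
    refine reflection_comm hi ?_ (by omega)
    rwa [← hs]
  · have h2 : (2 : ℤ) ∈ positions n := by rw [mem_positions]; omega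
    obtain ⟨b, hb, hgb⟩ : ∃ b ∈ positions n, extend g b = j := by
      refine ⟨extend g⁻¹ j, extend_mem _ hj, ?_⟩
      rw [← Function.comp_apply (f := extend g), ← extend_mul, mul_inv_cancel, extend_one, id]
    have hb1 : b ≠ 1 := fun e => hij (by rw [← hg, ← hgb, e])
    have hb2 : b ≠ -1 := fun e => hs (by rw [← hg, ← hgb, e, hc.odd])
    obtain ⟨k, hk1, hk2⟩ : ∃ k : SignedPerm n, extend k 1 = i ∧ extend k 2 = j := by
      by_cases h : b = 2
      · exact ⟨g, hg, by rw [← h, hgb]⟩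
      · refine ⟨g * reflection n 2 b, ?_, ?_⟩
        · have e : signedSwapInt 2 b 1 = 1 := by
            rw [signedSwapInt, if_neg (by decide), if_neg (Ne.symm hb1), if_neg (by decide),
              if_neg (by omega)]
          rw [extend_mul_reflection g h2 hb (fun e => h e.symm), Function.comp_apply, e, hg]
        · have e : signedSwapInt 2 b 2 = b := by simp [signedSwapInt]
          rw [extend_mul_reflection g h2 hb (fun e => h e.symm), Function.comp_apply, e, hgb]
    refine ⟨reflection n 1 2, mem_coxeterGenerators.2 ⟨1, h1, 2, h2, Or.inr ⟨le_refl _, rfl⟩, rfl⟩,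
      k, ?_⟩
    rw [conj_reflection k h1 h2 (by decide), hk1, hk2, mul_inv_cancel_right]

theorem exists_reflection_eq {t : SignedPerm n}
    (ht : IsBruhatReflection (coxeterGenerators n) t) :
    ∃ i ∈ positions n, ∃ j ∈ positions n, i ≠ j ∧ t = reflection n i j := by
  obtain ⟨s, hs, g, rfl⟩ := ht
  obtain ⟨i, hi, j, hj, hij, rfl⟩ := mem_coxeterGenerators.1 hs
  have hne : i ≠ j := by omega
  refine ⟨_, extend_mem g hi, _, extend_mem g hj, g.signedConfig.map_ne hne, ?_⟩
  rw [conj_reflection g hi hj hne, mul_inv_cancel_right]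

theorem bruhatStep_iff {g h : SignedPerm n} :
    BruhatStep (coxeterGenerators n) g h ↔ ∃ i ∈ positions n, ∃ j ∈ positions n,
      i < j ∧ extend g i < extend g j ∧ h = g * reflection n i j := by
  constructor
  · rintro ⟨t, ht, rfl, hlt⟩
    have hlt' : length₂ g < length₂ (t * g) := by
      rw [← two_mul_wordLength, ← two_mul_wordLength]
      omega
    obtain ⟨a, ha, b, hb, hab, rfl⟩ := exists_reflection_eq ht
    have hpre : ∀ x ∈ positions n, ∃ y ∈ positions n, extend g y = x := by
      intro x hx
      refine ⟨extend g⁻¹ x, extend_mem _ hx, ?_⟩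
      rw [← Function.comp_apply (f := extend g), ← extend_mul, mul_inv_cancel, extend_one, id]
    obtain ⟨i, hi, rfl⟩ := hpre a ha
    obtain ⟨j, hj, rfl⟩ := hpre b hb
    have hij : i ≠ j := fun e => hab (by rw [e])
    rw [← conj_reflection g hi hj hij] at hlt' ⊢
    have main : ∀ i ∈ positions n, ∀ j ∈ positions n, i < j →
        length₂ g < length₂ (g * reflection n i j) → extend g i < extend g j := by
      intro i hi j hj hij hl
      by_contra hge
      have := g.signedConfig.map_ne hij.ne
      have := (g.length₂_fall hi hj hij (by omega)).1
      omega
    rcases lt_or_gt_of_ne hij with h | h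
    · exact ⟨i, hi, j, hj, h, main i hi j hj h hlt', rfl⟩
    · rw [reflection_comm hi hj hij] at hlt' ⊢
      exact ⟨j, hj, i, hi, h, main j hj i hi h hlt', rfl⟩
  · rintro ⟨i, hi, j, hj, hij, hg, rfl⟩
    refine ⟨reflection n (extend g i) (extend g j), isBruhatReflection_reflection
      (extend_mem g hi) (extend_mem g hj) hg.ne, conj_reflection g hi hj hij.ne, ?_⟩
    have h1 := (g.length₂_rise hi hj hij hg).1
    rw [← two_mul_wordLength, ← two_mul_wordLength] at h1
    omega

theorem length₂_lt_of_lt {g h : SignedPerm n} (hgh : g < h) : length₂ g + 2 ≤ length₂ h := by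
  have hle : BruhatLE (coxeterGenerators n) g h := hgh.le
  have := hle.eq_or_length_lt.resolve_left hgh.ne
  rw [← two_mul_wordLength, ← two_mul_wordLength]
  omega

theorem lt_mul_reflection (g : SignedPerm n) {i j : ℤ} (hi : i ∈ positions n)
    (hj : j ∈ positions n) (hij : i < j) (hg : extend g i < extend g j) :
    g < g * reflection n i j := by
  have hs : BruhatStep (coxeterGenerators n) g (g * reflection n i j) :=
    bruhatStep_iff.2 ⟨i, hi, j, hj, hij, hg, rfl⟩
  refine lt_of_le_of_ne (Relation.ReflTransGen.single hs) fun e => ?_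
  have := (g.length₂_rise hi hj hij hg).1
  rw [← e] at this
  omega

/-- Each strict step costs at least 2 in the doubled length, and this rise has exactly 2 to spend.
-/
theorem covBy_mul_reflection (g : SignedPerm n) {i j : ℤ} (hi : i ∈ positions n)
    (hj : j ∈ positions n) (hij : i < j) (hg : extend g i < extend g j)
    (hf : FreePair (extend g) (positions n) i j) : g ⋖ g * reflection n i j := by
  refine ⟨g.lt_mul_reflection hi hj hij hg, fun c h1 h2 => ?_⟩
  have l1 := length₂_lt_of_lt h1
  have l2 := length₂_lt_of_lt h2
  have l3 := (g.length₂_rise hi hj hij hg).2 hf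
  omega

theorem exists_rise_of_covBy {g h : SignedPerm n} (hgh : g ⋖ h) :
    ∃ i ∈ positions n, ∃ j ∈ positions n,
      i < j ∧ extend g i < extend g j ∧ h = g * reflection n i j := by
  have hle : BruhatLE (coxeterGenerators n) g h := hgh.le
  rcases Relation.ReflTransGen.cases_head hle with e | ⟨c, hs, hch⟩
  · exact absurd e hgh.ne
  · obtain ⟨i, hi, j, hj, hij, hg, rfl⟩ := bruhatStep_iff.1 hs
    refine ⟨i, hi, j, hj, hij, hg, ?_⟩
    have hcle : g * reflection n i j ≤ h := hch
    rcases hcle.eq_or_lt with e | hlt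
    · exact e.symm
    · exact absurd hlt (hgh.2 (g.lt_mul_reflection hi hj hij hg))

theorem reflection_neg {i j : ℤ} (hi : i ∈ positions n) (hj : j ∈ positions n) (hij : i ≠ j) :
    reflection n i j = reflection n (-j) (-i) := by
  have hc := (1 : SignedPerm n).signedConfig
  have := (mem_positions.1 hi).1
  have := (mem_positions.1 hj).1
  apply extend_injective
  rw [extend_reflection hi hj hij, extend_reflection (hc.neg_mem j hj) (hc.neg_mem i hi) (by omega)]
  funext x
  simp only [signedSwapInt]
  split_ifs <;> omega

/-- A rise over a blocking position is not a covering. -/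
theorem not_covBy_of_blocks (g : SignedPerm n) {i j k : ℤ} (hi : i ∈ positions n)
    (hj : j ∈ positions n) (hk : k ∈ positions n) (hik : i < k) (hkj : k < j)
    (gik : extend g i < extend g k) (gkj : extend g k < extend g j)
    (hsym : (j = -i ∧ k < 0) ∨ (k ≠ -i ∧ k ≠ -j ∧ j ≠ -i)) :
    ¬ g ⋖ g * reflection n i j := by
  intro hcov
  have hi0 := (mem_positions.1 hi).1
  have hj0 := (mem_positions.1 hj).1
  have hk0 := (mem_positions.1 hk).1
  have hc := g.signedConfig
  -- The interchange of `i, j` is that of `k, m` conjugated by that of `i, k`. With `m = -k` in the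
  -- symmetric case and `m = j` otherwise, the three factors, applied in turn, are all rises.
  obtain ⟨m, hm, hkm, hmj⟩ : ∃ m ∈ positions n, k < m ∧ ((j = -i ∧ m = -k) ∨ (j ≠ -i ∧ m = j)) := by
    rcases hsym with ⟨h1, h2⟩ | ⟨h1, h2, h3⟩
    · exact ⟨-k, hc.neg_mem k hk, by omega, Or.inl ⟨h1, rfl⟩⟩
    · exact ⟨j, hj, hkj, Or.inr ⟨h3, rfl⟩⟩
  set g1 := g * reflection n i k with hg1
  set g2 := g1 * reflection n k m with hg2
  have e1 : extend g1 = extend g ∘ signedSwapInt i k := extend_mul_reflection g hi hk hik.ne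
  have e2 : extend g2 = extend g1 ∘ signedSwapInt k m := extend_mul_reflection g1 hk hm hkm.ne
  have v1 : extend g1 k = extend g i := by
    rw [e1, Function.comp_apply]
    congr 1
    simp only [signedSwapInt]
    split_ifs <;> omega
  have v2 : extend g1 m = extend g j := by
    rw [e1, Function.comp_apply]
    congr 1
    simp only [signedSwapInt]
    split_ifs <;> omega
  have v3 : extend g2 i = extend g k := by
    rw [e2, e1, Function.comp_apply, Function.comp_apply]
    congr 1
    simp only [signedSwapInt]
    split_ifs <;> omega
  have v4 : extend g2 k = extend g j := by
    rw [e2, Function.comp_apply, ← v2]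
    congr 1
    simp only [signedSwapInt]
    split_ifs <;> omega
  have e3 : g * reflection n i j = g2 * reflection n i k := by
    have c1 : signedSwapInt i k k = i := by
      simp only [signedSwapInt]
      split_ifs <;> omega
    have c2 : signedSwapInt i k m = j := by
      simp only [signedSwapInt]
      split_ifs <;> omega
    rw [hg2, hg1, mul_assoc, mul_assoc, ← mul_assoc (reflection n i k),
      conj_reflection _ hk hm hkm.ne, extend_reflection hi hk hik.ne, c1, c2, mul_assoc,
      reflection_mul_self hi hk hik.ne, mul_one]
  have s1 : g < g1 := g.lt_mul_reflection hi hk hik gik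
  have s2 : g1 < g2 := g1.lt_mul_reflection hk hm hkm (by omega)
  have s3 : g2 < g2 * reflection n i k := g2.lt_mul_reflection hi hk hik (by omega)
  rw [← e3] at s3
  exact hcov.2 s1 (s2.trans s3)

/-- A nonsymmetric rise over the origin is not a covering. -/
theorem not_covBy_of_central (g : SignedPerm n) {m j : ℤ} (hm : m ∈ positions n)
    (hj : j ∈ positions n) (hm0 : 0 < m) (hmj : m < j) (gm : 0 < extend g m)
    (gj : 0 < extend g j) : ¬ g ⋖ g * reflection n (-m) j := by
  intro hcov
  have hc := g.signedConfig
  have hnm := hc.neg_mem m hm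
  have hnj := hc.neg_mem j hj
  have om := hc.odd m
  have oj := hc.odd j
  have r1 : reflection n m j * reflection n (-m) m = reflection n (-j) j * reflection n m j := by
    have c1 : signedSwapInt m j (-m) = -j := by
      simp only [signedSwapInt]
      split_ifs <;> omega
    have c2 : signedSwapInt m j m = j := by simp [signedSwapInt]
    rw [conj_reflection _ hnm hm (by omega), extend_reflection hm hj hmj.ne, c1, c2]
  have r2 : reflection n (-j) j * reflection n m j = reflection n (-m) j * reflection n (-j) j := by
    have c1 : signedSwapInt (-j) j m = m := by
      simp only [signedSwapInt]
      split_ifs <;> omega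
    have c2 : signedSwapInt (-j) j j = -j := by
      simp only [signedSwapInt]
      split_ifs <;> omega
    rw [conj_reflection _ hm hj hmj.ne, extend_reflection hnj hj (by omega), c1, c2,
      reflection_neg hm hnj (by omega), neg_neg, reflection_comm hj hnm (by omega)]
  have r3 : reflection n (-m) m * reflection n m j = reflection n (-m) j * reflection n (-m) m := by
    have c1 : signedSwapInt (-m) m m = -m := by
      simp only [signedSwapInt]
      split_ifs <;> omega
    have c2 : signedSwapInt (-m) m j = j := by
      simp only [signedSwapInt]
      split_ifs <;> omega
    rw [conj_reflection _ hm hj hmj.ne, extend_reflection hnm hm (by omega), c1, c2]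
  -- The same reflection has two factorisations into three; which one consists of rises depends on
  -- whether `m, j` is itself a rise of `g`.
  rcases lt_or_gt_of_ne (hc.map_ne hmj.ne) with hlt | hgt
  · set g1 := g * reflection n m j with hg1
    set g2 := g1 * reflection n (-m) m with hg2
    have e1 : extend g1 = extend g ∘ signedSwapInt m j := extend_mul_reflection g hm hj hmj.ne
    have e2 : extend g2 = extend g1 ∘ signedSwapInt (-m) m :=
      extend_mul_reflection g1 hnm hm (by omega)
    have v1 : extend g1 m = extend g j := by
      rw [e1, Function.comp_apply]
      congr 1
      simp only [signedSwapInt]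
      split_ifs <;> omega
    have v2 : extend g2 j = extend g m := by
      rw [e2, e1, Function.comp_apply, Function.comp_apply]
      congr 1
      simp only [signedSwapInt]
      split_ifs <;> omega
    have e3 : g * reflection n (-m) j = g2 * reflection n (-j) j := by
      rw [hg2, hg1, mul_assoc g, r1, r2, mul_assoc, mul_assoc,
        reflection_mul_self hnj hj (by omega), mul_one]
    have o1 := g1.signedConfig.odd m
    have o2 := g2.signedConfig.odd j
    have s1 : g < g1 := g.lt_mul_reflection hm hj hmj hlt
    have s2 : g1 < g2 := g1.lt_mul_reflection hnm hm (by omega) (by omega)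
    have s3 : g2 < g2 * reflection n (-j) j := g2.lt_mul_reflection hnj hj (by omega) (by omega)
    rw [← e3] at s3
    exact hcov.2 s1 (s2.trans s3)
  · set g1 := g * reflection n (-m) m with hg1
    set g2 := g1 * reflection n (-j) j with hg2
    have e1 : extend g1 = extend g ∘ signedSwapInt (-m) m :=
      extend_mul_reflection g hnm hm (by omega)
    have e2 : extend g2 = extend g1 ∘ signedSwapInt (-j) j :=
      extend_mul_reflection g1 hnj hj (by omega)
    have v1 : extend g1 j = extend g j := by
      rw [e1, Function.comp_apply]
      congr 1
      simp only [signedSwapInt]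
      split_ifs <;> omega
    have v2 : extend g2 m = extend g (-m) := by
      rw [e2, e1, Function.comp_apply, Function.comp_apply]
      congr 1
      simp only [signedSwapInt]
      split_ifs <;> omega
    have v3 : extend g2 j = extend g (-j) := by
      rw [e2, e1, Function.comp_apply, Function.comp_apply]
      congr 1
      simp only [signedSwapInt]
      split_ifs <;> omega
    have e3 : g * reflection n (-m) j = g2 * reflection n m j := by
      rw [hg2, hg1, mul_assoc, mul_assoc, ← r1, ← mul_assoc (reflection n (-m) m), r3, mul_assoc,
        reflection_mul_self hnm hm (by omega), mul_one]
    have o1 := g1.signedConfig.odd j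
    have s1 : g < g1 := g.lt_mul_reflection hnm hm (by omega) (by omega)
    have s2 : g1 < g2 := g1.lt_mul_reflection hnj hj (by omega) (by omega)
    have s3 : g2 < g2 * reflection n m j := g2.lt_mul_reflection hm hj hmj (by omega)
    rw [← e3] at s3
    exact hcov.2 s1 (s2.trans s3)

theorem freePair_of_covBy (g : SignedPerm n) {i j : ℤ} (hi : i ∈ positions n)
    (hj : j ∈ positions n) (hij : i < j) (hg : extend g i < extend g j)
    (hcov : g ⋖ g * reflection n i j) : FreePair (extend g) (positions n) i j := by
  have hc := g.signedConfig
  have hi0 := hc.ne_zero hi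
  have hj0 := hc.ne_zero hj
  have oi := hc.odd i
  have oj := hc.odd j
  by_contra hf
  by_cases hs : j = -i
  · subst hs
    have : ∃ k ∈ positions n, Blocks (extend g) i (-i) k := by
      by_contra hno
      push Not at hno
      exact hf ⟨by omega, hno, Or.inl rfl⟩
    obtain ⟨k, hk, hb⟩ := this
    have hk0 := hc.ne_zero hk
    have ok := hc.odd k
    simp only [Blocks, StrictBtw] at hb
    rcases lt_or_gt_of_ne hk0 with h | h
    · exact g.not_covBy_of_blocks hi hj hk (by omega) (by omega) (by omega) (by omega)
        (Or.inl ⟨rfl, h⟩) hcov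
    · exact g.not_covBy_of_blocks hi hj (hc.neg_mem k hk) (by omega) (by omega) (by omega)
        (by omega) (Or.inl ⟨rfl, by omega⟩) hcov
  · have hgi := hc.map_ne_zero hi
    have hgj := hc.map_ne_zero hj
    by_cases hcen : (i < 0 ∧ 0 < j) ∧ (extend g i < 0 ∧ 0 < extend g j)
    · rcases lt_or_ge (-i) j with h | h
      · have := g.not_covBy_of_central (hc.neg_mem i hi) hj (by omega) h (by omega) (by omega)
        rw [neg_neg] at this
        exact this hcov
      · have := g.not_covBy_of_central hj (hc.neg_mem i hi) (by omega) (by omega) (by omega)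
          (by omega)
        rw [← reflection_neg hi hj hij.ne] at this
        exact this hcov
    · have : ∃ k ∈ positions n, Blocks (extend g) i j k := by
        by_contra hno
        push Not at hno
        refine hf ⟨hij.ne, hno, Or.inr ?_⟩
        simp only [Blocks, StrictBtw, hc.map_zero]
        omega
      obtain ⟨k, hk, hb⟩ := this
      simp only [Blocks, StrictBtw] at hb
      refine g.not_covBy_of_blocks hi hj hk (by omega) (by omega) (by omega) (by omega)
        (Or.inr ⟨?_, ?_, hs⟩) hcov
      -- A blocker equal to `-i` or `-j` would put the origin in the rectangle, which `hcen`
      -- excludes.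
      · rintro rfl
        omega
      · rintro rfl
        omega

/-- The elements related to `g` by a covering correspond to the free edges of `g`. -/
theorem totalDegree_eq (g : SignedPerm n) :
    totalDegree g = (freeEdges (extend g) (positions n)).card := by
  classical
  have hc := g.signedConfig
  set E := freeEdges (extend g) (positions n) with hE
  set φ : ℤ × ℤ → SignedPerm n := fun e => g * reflection n e.1 e.2 with hφ
  have hφinj : Set.InjOn φ E := by
    rintro ⟨i, j⟩ he ⟨i', j'⟩ he' heq
    obtain ⟨⟨hi, hj⟩, h1, h2, -⟩ := mem_freeEdges.1 he
    obtain ⟨⟨hi', hj'⟩, h1', h2', -⟩ := mem_freeEdges.1 he'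
    simp only at hi hj h1 h2 hi' hj' h1' h2'
    have heq' : reflection n i j = reflection n i' j' := mul_left_cancel heq
    have hi0 := hc.ne_zero hi
    have hi0' := hc.ne_zero hi'
    have hx : ∀ x, signedSwapInt i j x = signedSwapInt i' j' x := by
      rw [← extend_reflection hi hj h2.ne, ← extend_reflection hi' hj' h2'.ne, heq']
      exact fun _ => rfl
    have x1 := hx j
    have x2 := hx j'
    simp only [signedSwapInt] at x1 x2
    rw [Prod.mk.injEq]
    split_ifs at x1 x2 <;> constructor <;> omega
  have hup : {σ | g ⋖ σ} = φ '' (E.filter fun e => extend g e.1 < extend g e.2) := by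
    ext σ
    simp only [Set.mem_ofPred_eq, Set.mem_image, Finset.coe_filter]
    constructor
    · intro hcov
      obtain ⟨i, hi, j, hj, hij, hg, rfl⟩ := exists_rise_of_covBy hcov
      have hf := g.freePair_of_covBy hi hj hij hg hcov
      by_cases hrep : -j ≤ i
      · exact ⟨(i, j), ⟨mem_freeEdges.2 ⟨⟨hi, hj⟩, hrep, hij, hf⟩, hg⟩, rfl⟩
      -- The opposite pair defines the same reflection and satisfies the normalisation.
      · refine ⟨(-j, -i), ⟨mem_freeEdges.2 ⟨⟨hc.neg_mem j hj, hc.neg_mem i hi⟩, ?_, ?_,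
          (hc.freePair_neg hf).symm⟩, ?_⟩, ?_⟩
        · simp only; omega
        · simp only; omega
        · simp only [hc.odd]; omega
        · simp only [hφ]
          rw [← reflection_neg hi hj hij.ne]
    · rintro ⟨⟨i, j⟩, ⟨he, hg⟩, rfl⟩
      obtain ⟨⟨hi, hj⟩, -, hij, hf⟩ := mem_freeEdges.1 he
      exact g.covBy_mul_reflection hi hj hij hg hf
  have hdown : {σ | σ ⋖ g} = φ '' (E.filter fun e => ¬ extend g e.1 < extend g e.2) := by
    ext σ
    simp only [Set.mem_ofPred_eq, Set.mem_image, Finset.coe_filter]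
    constructor
    · intro hcov
      obtain ⟨i, hi, j, hj, hij, hg, hgσ⟩ := exists_rise_of_covBy hcov
      have hσ : σ = g * reflection n i j := by
        rw [hgσ, mul_assoc, reflection_mul_self hi hj hij.ne, mul_one]
      have hfσ := σ.freePair_of_covBy hi hj hij hg (hgσ ▸ hcov)
      have hext : extend g = extend σ ∘ signedSwapInt i j := by
        rw [hgσ, extend_mul_reflection σ hi hj hij.ne]
      have hf : FreePair (extend g) (positions n) i j := by
        rw [hext]
        exact σ.signedConfig.freePair_comp_signedSwapInt hi hj hfσ
      have v1 : extend g i = extend σ j := by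
        rw [hext, Function.comp_apply]
        simp [signedSwapInt]
      have v2 : extend g j = extend σ i := by
        rw [hext, Function.comp_apply]
        congr 1
        simp only [signedSwapInt]
        split_ifs <;> omega
      by_cases hrep : -j ≤ i
      · refine ⟨(i, j), ⟨mem_freeEdges.2 ⟨⟨hi, hj⟩, hrep, hij, hf⟩, ?_⟩, hσ.symm⟩
        simp only
        omega
      · refine ⟨(-j, -i), ⟨mem_freeEdges.2 ⟨⟨hc.neg_mem j hj, hc.neg_mem i hi⟩, ?_, ?_,
          (hc.freePair_neg hf).symm⟩, ?_⟩, ?_⟩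
        · simp only; omega
        · simp only; omega
        · simp only [hc.odd]; omega
        · simp only [hφ]
          rw [← reflection_neg hi hj hij.ne, hσ]
    · rintro ⟨⟨i, j⟩, ⟨he, hg⟩, rfl⟩
      obtain ⟨⟨hi, hj⟩, -, hij, hf⟩ := mem_freeEdges.1 he
      simp only at hi hj hij hf hg
      simp only [hφ]
      have hne := hc.map_ne hij.ne
      set σ := g * reflection n i j with hσ
      have hgσ : g = σ * reflection n i j := by
        rw [hσ, mul_assoc, reflection_mul_self hi hj hij.ne, mul_one]
      have hext : extend σ = extend g ∘ signedSwapInt i j :=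
        extend_mul_reflection g hi hj hij.ne
      have v1 : extend σ i = extend g j := by
        rw [hext, Function.comp_apply]
        simp [signedSwapInt]
      have v2 : extend σ j = extend g i := by
        rw [hext, Function.comp_apply]
        congr 1
        simp only [signedSwapInt]
        split_ifs <;> omega
      have hcov := σ.covBy_mul_reflection hi hj hij (by omega)
        (by rw [hext]; exact hc.freePair_comp_signedSwapInt hi hj hf)
      rwa [← hgσ] at hcov
  rw [totalDegree, downDegree, upDegree, hup, hdown,
    (hφinj.mono (Finset.coe_subset.2 (Finset.filter_subset _ _))).ncard_image,
    (hφinj.mono (Finset.coe_subset.2 (Finset.filter_subset _ _))).ncard_image, Set.ncard_coe_finset, Set.ncard_coe_finset,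
    add_comm, Finset.card_filter_add_card_filter_not]

end SignedPerm

/-! ### Signed permutations of large degree -/

theorem freeEdges_congr {v w : ℤ → ℤ} {S : Finset ℤ} (h : ∀ x ∈ S, v x = w x) (h0 : v 0 = w 0) :
    freeEdges v S = freeEdges w S := by
  ext e
  rw [mem_freeEdges, mem_freeEdges]
  refine and_congr_right fun he => and_congr_right fun _ => and_congr_right fun _ => ?_
  simp only [FreePair, Blocks, h _ he.1, h _ he.2, h0]
  refine and_congr_right fun _ => and_congr_left fun _ => forall₂_congr fun k hk => ?_
  rw [h k hk]

theorem SignedPerm.exists_totalDegree_eq {n : ℕ} {w : ℤ → ℤ} (hodd : ∀ x, w (-x) = -w x)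
    (hmem : ∀ x ∈ positions n, w x ∈ positions n) (hinj : Set.InjOn w (positions n)) :
    ∃ g : SignedPerm n, totalDegree g = (freeEdges w (positions n)).card := by
  let f : SignedIdx n → SignedIdx n := fun x => ⟨w x.1, hmem x.1 x.2⟩
  have hf : Function.Injective f := fun x y e =>
    Subtype.ext (hinj x.2 y.2 (congrArg Subtype.val e))
  let g : SignedPerm n :=
    ⟨Equiv.ofBijective f (Finite.injective_iff_bijective.1 hf), fun x => Subtype.ext (hodd x.1)⟩
  refine ⟨g, ?_⟩
  have h0 : w 0 = 0 := by
    have := hodd 0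
    rw [neg_zero] at this
    omega
  rw [g.totalDegree_eq, freeEdges_congr (w := w) (fun x hx => g.extend_of_mem hx)
    (g.signedConfig.map_zero.trans h0.symm)]

/-- The function that negates `1, …, m` and reverses `m + 1, …, n`. -/
def negReverse (m n x : ℤ) : ℤ :=
  if -m ≤ x ∧ x ≤ m then -x else if 0 < x then n + m + 1 - x else -(n + m + 1) - x

/-- The diagram has decreasing blocks over `±1, …, ±m` and over `m + 1, …, n`, the latter entirely
above and to the right. Every pair with one point in each is free, and so are pairs of neighbouring
positions. -/
theorem le_card_freeEdges_negReverse {m n : ℕ} (hm : 0 < m) (hmn : m < n) :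
    2 * m * (n - m) + (n - 1) ≤ (freeEdges (negReverse m n) (positions n)).card := by
  set A : Finset (ℤ × ℤ) := positions m ×ˢ Finset.Icc ((m : ℤ) + 1) n with hA
  -- Pairs of neighbours `j - 1, j`, with `-1, 1` in place of `0, 1`; the pair `m, m + 1` is omitted
  -- because it is in `A`.
  set B : Finset (ℤ × ℤ) := ((Finset.Icc (1 : ℤ) n).erase (m + 1)).image
    fun j => (if j = 1 then -1 else j - 1, j) with hB
  have cA : A.card = 2 * m * (n - m) := by
    rw [hA, Finset.card_product, card_positions, Int.card_Icc]
    congr 1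
    omega
  have cB : B.card = n - 1 := by
    rw [hB, Finset.card_image_of_injective _ fun x y e => (Prod.mk.injEq _ _ _ _ ▸ e).2,
      Finset.card_erase_of_mem (Finset.mem_Icc.2 (by omega)), Int.card_Icc]
    omega
  have hdisj : Disjoint A B := by
    rw [Finset.disjoint_left]
    rintro ⟨i, j⟩ h1 h2
    simp only [hA, hB, Finset.mem_product, Finset.mem_Icc, Finset.mem_image, Finset.mem_erase,
      Prod.mk.injEq] at h1 h2
    obtain ⟨y, h3, h4, rfl⟩ := h2
    split_ifs at h4 <;> omega
  rw [← cA, ← cB, ← Finset.card_union_of_disjoint hdisj]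
  refine Finset.card_le_card fun e he => ?_
  obtain ⟨i, j⟩ := e
  rcases Finset.mem_union.1 he with h | h
  · simp only [hA, Finset.mem_product, mem_positions, Finset.mem_Icc] at h
    have wi : negReverse m n i = -i := if_pos (by omega)
    have wj : negReverse m n j = n + m + 1 - j := by
      rw [negReverse, if_neg (by omega), if_pos (by omega)]
    have hno : ∀ k, ¬ Blocks (negReverse m n) i j k := by
      intro k hb
      simp only [Blocks, StrictBtw, wi, wj] at hb
      simp only [negReverse] at hb
      split_ifs at hb <;> omega
    refine mem_freeEdges.2 ⟨⟨mem_positions.2 ?_, mem_positions.2 ?_⟩, ?_, ?_, ?_, fun k _ => hno k,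
      Or.inr (hno 0)⟩ <;> simp only <;> omega
  · simp only [hB, Finset.mem_image, Finset.mem_erase, Finset.mem_Icc, Prod.mk.injEq] at h
    obtain ⟨y, h3, h4, rfl⟩ := h
    have hy : (i = -1 ∧ y = 1) ∨ (0 < i ∧ y = i + 1) := by
      split_ifs at h4 <;> omega
    refine mem_freeEdges.2 ⟨⟨mem_positions.2 ?_, mem_positions.2 ?_⟩, ?_, ?_, ?_, fun k hk hb => ?_,
      ?_⟩
    any_goals (simp only; omega)
    · have := (mem_positions.1 hk).1
      simp only [Blocks, StrictBtw] at hb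
      omega
    · simp only [Blocks, StrictBtw]
      omega

theorem two_mul_half_mul (n : ℕ) : 2 * (n / 2) * (n - n / 2) = n ^ 2 / 2 := by
  obtain ⟨k, rfl | rfl⟩ := n.even_or_odd'
  · rw [Nat.mul_div_cancel_left _ two_pos, show (2 * k) ^ 2 = 2 * (2 * k * k) by ring,
      Nat.mul_div_cancel_left _ two_pos, show 2 * k - k = k by omega]
  · rw [show (2 * k + 1) / 2 = k by omega, show 2 * k + 1 - k = k + 1 by omega,
      show (2 * k + 1) ^ 2 = 2 * (2 * k * (k + 1)) + 1 by ring]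
    omega

theorem SignedPerm.exists_sq_le_totalDegree {n : ℕ} (hn : 2 ≤ n) :
    ∃ g : SignedPerm n, n ^ 2 / 2 + n - 1 ≤ totalDegree g := by
  -- The half maximises `2 m (n - m)`, giving `⌊n²/2⌋`.
  obtain ⟨m, hm⟩ : ∃ m, m = n / 2 := ⟨_, rfl⟩
  obtain ⟨g, hg⟩ := SignedPerm.exists_totalDegree_eq (n := n) (w := negReverse m n)
    (fun x => by simp only [negReverse]; split_ifs <;> omega)
    (fun x hx => by
      rw [mem_positions] at hx ⊢
      simp only [negReverse]
      split_ifs <;> omega)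
    (fun x hx y hy e => by
      have hx := mem_positions.1 hx
      have hy := mem_positions.1 hy
      simp only [negReverse] at e
      split_ifs at e <;> omega)
  have h := le_card_freeEdges_negReverse (m := m) (n := n) (by omega) (by omega)
  rw [hm, two_mul_half_mul, ← hm, ← hg] at h
  exact ⟨g, by omega⟩

/-- The odd function with the values `l` at `1, 2, …`. -/
def oddFun (l : List ℤ) (x : ℤ) : ℤ := x.sign * l.getD (x.natAbs - 1) 0

theorem oddFun_neg (l : List ℤ) (x : ℤ) : oddFun l (-x) = -oddFun l x := by
  rw [oddFun, oddFun, Int.sign_neg, Int.natAbs_neg, neg_mul]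

theorem SignedPerm.exists_totalDegree_eq_of_le_four {n : ℕ} (h2 : 2 ≤ n) (h4 : n ≤ 4) :
    ∃ g : SignedPerm n, totalDegree g = 4 * (n - 1) := by
  have key : ∀ l : List ℤ, (∀ x ∈ positions n, oddFun l x ∈ positions n) →
      (∀ x ∈ positions n, ∀ y ∈ positions n, oddFun l x = oddFun l y → x = y) →
      (freeEdges (oddFun l) (positions n)).card = 4 * (n - 1) →
      ∃ g : SignedPerm n, totalDegree g = 4 * (n - 1) := by
    intro l h1 h2 h3
    rw [← h3]
    exact SignedPerm.exists_totalDegree_eq (oddFun_neg l) h1 fun x hx y hy => h2 x hx y hy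
  interval_cases n
  · exact key [2, -1] (by decide +kernel) (by decide +kernel) (by decide +kernel)
  · exact key [3, -2, 1] (by decide +kernel) (by decide +kernel) (by decide +kernel)
  · exact key [4, -3, -2, 1] (by decide +kernel) (by decide +kernel) (by decide +kernel)

theorem theorem4p1 (n : ℕ) :
    (2 ≤ n → n ≤ 5 →
      IsGreatest (Set.range fun π : SignedPerm n => totalDegree π) (4 * (n - 1))) ∧
    (5 ≤ n →
      IsGreatest (Set.range fun π : SignedPerm n => totalDegree π) (n ^ 2 / 2 + n - 1)) := by
  have small : 2 ≤ n → n ≤ 5 → ∀ g : SignedPerm n, totalDegree g ≤ 4 * (n - 1) := by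
    intro h2 h5 g
    rw [g.totalDegree_eq]
    exact g.signedConfig.card_freeEdges_le_of_le_five (card_positions n) h2 h5
  have large : 5 ≤ n → ∀ g : SignedPerm n, totalDegree g ≤ n ^ 2 / 2 + n - 1 := by
    intro h5 g
    rw [g.totalDegree_eq]
    exact SignedConfig.card_freeEdges_le_of_five_le n g.signedConfig (card_positions n) h5
  refine ⟨fun h2 h5 => ⟨?_, ?_⟩, fun h5 => ⟨?_, ?_⟩⟩
  -- At `n = 5` both formulas give 16, so the general construction serves here as well.
  · rcases h5.eq_or_lt with rfl | h
    · obtain ⟨g, hg⟩ := SignedPerm.exists_sq_le_totalDegree h2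
      exact ⟨g, le_antisymm (small h2 h5 g) hg⟩
    · exact SignedPerm.exists_totalDegree_eq_of_le_four h2 (by omega)
  · rintro _ ⟨g, rfl⟩
    exact small h2 h5 g
  · obtain ⟨g, hg⟩ := SignedPerm.exists_sq_le_totalDegree (by omega : 2 ≤ n)
    exact ⟨g, le_antisymm (large h5 g) hg⟩
  · rintro _ ⟨g, rfl⟩
    exact large h5 g
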